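/- **Setting.** Let $(V,\omega)$ be a real symplectic vector space of dimension $2g$, $Z\subset V$ a self-dual lattice ($Z=\{X\in V:\omega(X,W)\in\mathbb Z\ \forall W\in Z\}$), and $k$ a positive even integer. The prequantum line bundle $\mathcal L$ of the torus $(V/Z,k\omega)$ is the quotient of $V\times\mathbb C$ by the action $W\cdot(X,z)=(X+W,e^{\pi i k\omega(W,X)}z)$ of $Z$, with the connection induced by $d-2\pi i k\,\theta$, $\theta_X(Y)=\tfrac12\omega(X,Y)$. An invariant real polarization $P$ is given by a Lagrangian subspace $L_P\subset V$ spanned by $L_P\cap Z$; its leaves $\Lambda$ are the images in $V/Z$ of the translates of $L_P$. Let $S_\Lambda$ be the space of covariantly constant sections over $\Lambda$ of $\mathcal L\otimes|\det P^*|^{1/2}$ (half-densities of $P$), and let $\mathcal H_P=\bigoplus_\Lambda S_\Lambda$, the sum being over the Bohr–Sommerfeld leaves (those over which this flat line bundle is trivial), with inner product $\langle s\otimes\mu,s'\otimes\mu'\rangle=\int_\Lambda (s,s')\,\mu\mu'$ on $S_\Lambda$, distinct $S_\Lambda$ being orthogonal. For polarizations $P_1,P_2$, the operator $F_{P_2P_1}:\mathcal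 H_{P_1}\to\mathcal H_{P_2}$ is defined by $\langle\psi_2,F_{P_2P_1}\psi_1\rangle=\langle\langle\psi_2,\psi_1\rangle\rangle$, where the Blattner–Kostant–Sternberg pairing is $\langle\langle s_2\otimes\mu_2,s_1\otimes\mu_1\rangle\rangle=\int_{\Lambda_2\cap\Lambda_1}(s_2,s_1)\,\mu_2*\mu_1$ and $(\mu_2*\mu_1)(\underline W)=\mu_2(\underline V_2,\underline W)\,\mu_1(\underline V_1,\underline W)$ for any bases $\underline W$ of $L_{P_1}\cap L_{P_2}$, $(\underline V_a,\underline W)$ of $L_{P_a}$, $a=1,2$, and vectors $\underline T$ such that $(\underline V_2,\underline W,\underline V_1,\underline T)$ is a basis of $V$ with $k\omega(V_{2i},V_{1j})=\delta_{ij}$, $k\omega(W_i,T_j)=\delta_{ij}$, $k\omega(V_{1i},T_j)=k\omega(V_{2i},T_j)=0$. The Heisenberg group $H_k$ is the quotient of the group $\mathbb T\times\frac1kZ$, with the law $(\lambda,X)(\lambda',X')=(\lambda\lambda'e^{\pi i k\omega(X,X')},X+X')$, by the central subgroup $\{(1,W):W\in Z\}$. It acts on $\mathcal H_P$ by $\big((\lambda,X')\cdot\psi\big)(X)=\lambda\,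 X'\cdot\psi(X-X')$, where $X'\cdot(X,z)=(X+X',e^{\pi i k\omega(X',X)}z)$, sections being regarded as $Z$-invariant sections over $V$ and the translations leaving the constant half-densities unchanged. **Theorem.** (a) $H_k$ is a central extension $1\to\mathbb T\to H_k\to\frac1kZ/Z\to0$. (b) For every invariant real polarization $P$, the action of $H_k$ on $\mathcal H_P$ is unitary, and $(\lambda,0)$ acts as $\lambda I$. There are symplectic bases $(W_i;W_i^\perp)$ of $V$, $\omega(W_i,W_j^\perp)=\delta_{ij}$, that are bases of $Z$ and satisfy $L_P=\operatorname{span}_{\mathbb R}\{W_1,\dots,W_g\}$. For every such basis, the sections $\sigma_{\mathbf q}=s_{\mathbf q}\otimes\delta$, $\mathbf q\in(\mathbb Z/k\mathbb Z)^g$, form an orthonormal basis of $\mathcal H_P$, where $\delta$ is the half-density with $\delta(W_1,\dots,W_g)=1$ and $s_{\mathbf q}$ is supported on the leaf $\{k\,\omega(W_i,X)\equiv q_i \bmod k,\ i=1,\dots,g\}$, where it is $e^{-2\pi i kK(X)}$ with $K(X)=\tfrac12\sum_i\omega(X,W_i^\perp)\,\omega(W_i,X)$. In this basis $$(\lambda,\tfrac1kW_i)\cdot\sigma_{\mathbf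 q}=\lambda e^{2\pi i q_i/k}\sigma_{\mathbf q},\qquad(\lambda,\tfrac1kW_i^\perp)\cdot\sigma_{\mathbf q}=\lambda\,\sigma_{\mathbf q+e_i}.$$ (c) For any two invariant real polarizations $P_1,P_2$, the operator $F_{P_2P_1}$ exists, is unique, and intertwines the representations of $H_k$ on $\mathcal H_{P_1}$ and $\mathcal H_{P_2}$. -/

import Mathlib

/-- A symplectic torus `(V / Z, k ω)`: a real vector space `V` of dimension `2 g` with a linear
symplectic form `ω`, a self-dual lattice `Z`, and a positive even level `k`. -/
structure SymplecticTorus (g : ℕ) (V : Type*) [AddCommGroup V] [Module ℝ V] where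
  /-- the symplectic form -/
  ω : LinearMap.BilinForm ℝ V
  isAlt : ω.IsAlt
  nondegenerate : ω.Nondegenerate
  /-- the lattice -/
  Z : Submodule ℤ V
  isLattice : ∃ b : Module.Basis (Fin (2 * g)) ℝ V, Z = Submodule.span ℤ (Set.range b)
  selfDual : ∀ X : V, X ∈ Z ↔ ∀ W ∈ Z, ∃ n : ℤ, ω X W = n
  /-- the level -/
  k : ℕ
  k_pos : 0 < k
  k_even : Even k

namespace SymplecticTorus

/-! ### Linear algebra of lattices and Lagrangian subspaces -/

theorem exists_int_basis_of_le_span {V : Type*} [AddCommGroup V] [Module ℝ V] {n : ℕ} (b : Module.Basis (Fin n) ℝ V)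
    (N : Submodule ℤ V) (hN : N ≤ Submodule.span ℤ (Set.range b)) :
    ∃ w : Fin (Module.finrank ℤ N) → V, LinearIndependent ℝ w ∧
      Submodule.span ℤ (Set.range w) = N := by
  set O := Submodule.span ℤ (Set.range b) with hO
  let bZ : Module.Basis (Fin n) ℤ O := b.restrictScalars ℤ
  obtain ⟨m, ⟨bM, bN, f, a, hsnf⟩⟩ := Submodule.smithNormalForm bZ (N.comap O.subtype)
  have hbM : LinearIndependent ℝ (fun i => (bM i : V)) := by
    have : FiniteDimensional ℝ V := Module.Basis.finiteDimensional_of_finite b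
    refine linearIndependent_of_top_le_span_of_card_eq_finrank ?_ ?_
    · rw [← b.span_eq, Submodule.span_le]
      rintro _ ⟨i, rfl⟩
      have h1 := bM.sum_repr (bZ i)
      have h2 : b i = ∑ j, (bM.repr (bZ i) j) • (bM j : V) := by
        have h3 : ((bZ i : O) : V) = b i := b.restrictScalars_apply ℤ i
        have h4 := congrArg O.subtype h1
        rw [map_sum] at h4
        rw [← h3]
        simpa only [map_smul, Submodule.subtype_apply] using h4.symm
      rw [h2]
      refine Submodule.sum_mem _ fun j _ => ?_
      rw [← Int.cast_smul_eq_zsmul ℝ]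
      exact Submodule.smul_mem _ _ (Submodule.subset_span ⟨j, rfl⟩)
    · simpa using (Module.finrank_eq_card_basis b).symm
  let bN' : Module.Basis (Fin m) ℤ N := bN.map (Submodule.comapSubtypeEquivOfLe hN)
  have hm : Module.finrank ℤ N = m := by simpa using Module.finrank_eq_card_basis bN'
  have hval : ∀ i, (bN' i : V) = a i • (bM (f i) : V) := by
    intro i
    have := congrArg (Subtype.val) (hsnf i)
    simpa [bN'] using this
  have ha : ∀ i, a i ≠ 0 := by
    intro i h
    have h1 := hval i
    rw [h, zero_smul] at h1
    exact bN'.ne_zero i (Subtype.ext h1)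
  rw [hm]
  refine ⟨fun i => (bN' i : V), ?_, ?_⟩
  · have h1 : LinearIndependent ℝ (fun i => (bM (f i) : V)) := hbM.comp f f.injective
    have h2 := h1.units_smul (fun i => Units.mk0 ((a i : ℤ) : ℝ) (by exact_mod_cast ha i))
    convert h2 using 1
    funext i
    rw [hval]
    simp [Units.smul_def, Int.cast_smul_eq_zsmul]
  · have := bN'.span_eq
    have h3 := congrArg (Submodule.map N.subtype) this
    rw [Submodule.map_span, ← Set.range_comp] at h3
    simpa [Function.comp_def] using h3

theorem finrank_span_int {V : Type*} [AddCommGroup V] [Module ℝ V] {n : ℕ} (b : Module.Basis (Fin n) ℝ V)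
    (N : Submodule ℤ V) (hN : N ≤ Submodule.span ℤ (Set.range b)) :
    Module.finrank ℝ (Submodule.span ℝ (N : Set V)) = Module.finrank ℤ N := by
  obtain ⟨w, hw, hs⟩ := exists_int_basis_of_le_span b N hN
  have h : Submodule.span ℝ (N : Set V) = Submodule.span ℝ (Set.range w) := by
    refine le_antisymm (Submodule.span_le.2 ?_) (Submodule.span_mono ?_)
    · conv_lhs => rw [← hs]
      exact Submodule.span_le_restrictScalars ℤ ℝ _
    · conv_rhs => rw [← hs]
      exact Submodule.subset_span
  rw [h]
  simpa using finrank_span_eq_card hw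

theorem rational_inf {V : Type*} [AddCommGroup V] [Module ℝ V] {n : ℕ} (b : Module.Basis (Fin n) ℝ V)
    (Z : Submodule ℤ V) (hZ : Z = Submodule.span ℤ (Set.range b)) (L₁ L₂ : Submodule ℝ V)
    (h₁ : Submodule.span ℝ ((L₁ : Set V) ∩ Z) = L₁) (h₂ : Submodule.span ℝ ((L₂ : Set V) ∩ Z) = L₂) :
    Submodule.span ℝ (((L₁ ⊓ L₂ : Submodule ℝ V) : Set V) ∩ Z) = L₁ ⊓ L₂ := by
  have := Module.Basis.finiteDimensional_of_finite b
  subst hZ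
  set Z := Submodule.span ℤ (Set.range b) with hZ
  let N₁ : Submodule ℤ V := L₁.restrictScalars ℤ ⊓ Z
  let N₂ : Submodule ℤ V := L₂.restrictScalars ℤ ⊓ Z
  have e₁ : (N₁ : Set V) = (L₁ : Set V) ∩ Z := rfl
  have e₂ : (N₂ : Set V) = (L₂ : Set V) ∩ Z := rfl
  have e : ((N₁ ⊓ N₂ : Submodule ℤ V) : Set V) = ((L₁ ⊓ L₂ : Submodule ℝ V) : Set V) ∩ Z := by
    ext x; simp [N₁, N₂]; tauto
  have hf : Module.Finite ℤ Z := Module.Finite.of_basis (b.restrictScalars ℤ)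
  have hle : ∀ N : Submodule ℤ V, N ≤ Z → Module.Finite ℤ N := by
    intro N hN
    exact Module.Finite.of_injective (Submodule.inclusion hN) (Submodule.inclusion_injective hN)
  have r₁ := finrank_span_int b N₁ inf_le_right
  have r₂ := finrank_span_int b N₂ inf_le_right
  have r₁₂ := finrank_span_int b (N₁ ⊓ N₂) (inf_le_left.trans inf_le_right)
  have rs := finrank_span_int b (N₁ ⊔ N₂) (sup_le inf_le_right inf_le_right)
  have f₁ := hle N₁ inf_le_right
  have f₂ := hle N₂ inf_le_right
  have f₁₂ := hle (N₁ ⊓ N₂) (inf_le_left.trans inf_le_right)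
  have fs := hle (N₁ ⊔ N₂) (sup_le inf_le_right inf_le_right)
  have hs : Submodule.span ℝ ((N₁ ⊔ N₂ : Submodule ℤ V) : Set V) = L₁ ⊔ L₂ := by
    apply le_antisymm
    · rw [Submodule.span_le]
      have : N₁ ⊔ N₂ ≤ (L₁ ⊔ L₂).restrictScalars ℤ :=
        sup_le (inf_le_left.trans fun x hx => (le_sup_left : L₁ ≤ L₁ ⊔ L₂) hx)
          (inf_le_left.trans fun x hx => (le_sup_right : L₂ ≤ L₁ ⊔ L₂) hx)
      exact this
    · refine sup_le ?_ ?_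
      · rw [← h₁, ← e₁]
        exact Submodule.span_mono (le_sup_left : N₁ ≤ N₁ ⊔ N₂)
      · rw [← h₂, ← e₂]
        exact Submodule.span_mono (le_sup_right : N₂ ≤ N₁ ⊔ N₂)
  rw [e₁, h₁] at r₁
  rw [e₂, h₂] at r₂
  rw [hs] at rs
  have dR := Submodule.finrank_sup_add_finrank_inf_eq L₁ L₂
  have dZ : Module.finrank ℤ (N₁ ⊔ N₂ : Submodule ℤ V) + Module.finrank ℤ (N₁ ⊓ N₂ : Submodule ℤ V)
      = Module.finrank ℤ N₁ + Module.finrank ℤ N₂ := by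
    have hr := Submodule.rank_sup_add_rank_inf_eq N₁ N₂
    rw [← Module.finrank_eq_rank, ← Module.finrank_eq_rank, ← Module.finrank_eq_rank,
      ← Module.finrank_eq_rank] at hr
    exact_mod_cast hr
  rw [← e]
  refine Submodule.eq_of_le_of_finrank_eq ?_ ?_
  · rw [Submodule.span_le, e]; exact Set.inter_subset_left
  · omega

theorem exists_pairing_eq {V : Type*} [AddCommGroup V] [Module ℝ V] [FiniteDimensional ℝ V] (ω : LinearMap.BilinForm ℝ V)
   (hω : ω.Nondegenerate) {ι : Type*} [Finite ι] (u : ι → V) (hu : LinearIndependent ℝ u) (c : ι → ℝ) :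
   ∃ T : V, ∀ i, ω (u i) T = c i := by
  let B := Module.Basis.span hu
  obtain ⟨f, hf⟩ := LinearMap.exists_extend (B.constr ℝ c)
  have hω' : ω.flip.Nondegenerate := LinearMap.BilinForm.nondegenerate_flip_iff.mpr hω
  obtain ⟨T, hT⟩ := (LinearMap.BilinForm.toDual ω.flip hω').surjective f
  refine ⟨T, fun i => ?_⟩
  have h1 : ω (u i) T = f (u i) := by rw [← hT]; rfl
  have h2 : f (u i) = B.constr ℝ c (B i) := by
    rw [← hf]; simp [B]
  rw [h1, h2, Module.Basis.constr_basis]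

theorem linearIndependent_of_pairing {V : Type*} [AddCommGroup V] [Module ℝ V] (ω : LinearMap.BilinForm ℝ V)
   (hω : ω.IsAlt) {k : ℝ} {α δ κ : Type*} [Fintype α] [Fintype δ] [Fintype κ]
   [DecidableEq α] [DecidableEq δ]
   (v₁ v₂ : α → V) (w : δ → V) (T : κ → V) (e : κ → δ) (he : Function.Injective e) (hw : LinearIndependent ℝ w)
   (h11 : ∀ i j, ω (v₁ i) (v₁ j) = 0) (h22 : ∀ i j, ω (v₂ i) (v₂ j) = 0)
   (h1w : ∀ i j, ω (v₁ i) (w j) = 0) (h2w : ∀ i j, ω (v₂ i) (w j) = 0)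
   (hww : ∀ i j, ω (w i) (w j) = 0)
   (h21 : ∀ i j, k * ω (v₂ i) (v₁ j) = if i = j then 1 else 0)
   (hwT : ∀ i j, k * ω (w i) (T j) = if i = e j then 1 else 0)
   (h1T : ∀ i j, ω (v₁ i) (T j) = 0) (h2T : ∀ i j, ω (v₂ i) (T j) = 0) :
   LinearIndependent ℝ (Sum.elim (Sum.elim v₂ w) (Sum.elim v₁ T)) := by
  classical
  rw [Fintype.linearIndependent_iff]
  intro c hc
  have sk : ∀ x y, ω x y = - ω y x := fun x y => (hω.neg_eq y x).symm
  simp only [Fintype.sum_sum_type, Sum.elim_inl, Sum.elim_inr] at hc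
  have key : ∀ x, k * ω x (((∑ i, c (.inl (.inl i)) • v₂ i) + ∑ i, c (.inl (.inr i)) • w i) +
     ((∑ i, c (.inr (.inl i)) • v₁ i) + ∑ i, c (.inr (.inr i)) • T i)) = 0 := by
    intro x; rw [hc]; simp
  simp only [map_add, map_sum, map_smul, smul_eq_mul] at key
  have hT : ∀ j, c (.inr (.inr j)) = 0 := by
    intro j
    have := key (w (e j))
    simp only [hww, fun i j => sk (w i) (v₂ j), fun i j => sk (w i) (v₁ j), h1w, h2w, mul_zero, neg_zero,
      Finset.sum_const_zero, zero_add, Finset.mul_sum] at this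
    simp only [mul_left_comm k, hwT, he.eq_iff, mul_ite, mul_one, mul_zero] at this
    simpa using this
  have h2 : ∀ j, c (.inl (.inl j)) = 0 := by
    intro j
    have := key (v₁ j)
    simp only [h11, h1w, h1T, fun i j => sk (v₁ i) (v₂ j), mul_zero, Finset.sum_const_zero, add_zero,
      Finset.mul_sum, mul_neg] at this
    simp only [mul_left_comm k, h21, mul_ite, mul_one, mul_zero] at this
    simpa using this
  have h1 : ∀ j, c (.inr (.inl j)) = 0 := by
    intro j
    have := key (v₂ j)
    simp only [h22, h2w, h2T, mul_zero, Finset.sum_const_zero, add_zero, zero_add,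
      Finset.mul_sum] at this
    simp only [mul_left_comm k, h21, mul_ite, mul_one, mul_zero] at this
    simpa using this
  simp only [hT, h1, h2, zero_smul, Finset.sum_const_zero, add_zero, zero_add] at hc
  have hb := Fintype.linearIndependent_iff.1 hw _ hc
  rintro ((i | i) | (i | i))
  exacts [h2 i, hb i, h1 i, hT i]

theorem mem_of_forall_pairing_eq_zero {V : Type*} [AddCommGroup V] [Module ℝ V] [FiniteDimensional ℝ V]
   (ω : LinearMap.BilinForm ℝ V) (hn : ω.Nondegenerate) {g : ℕ}
   (hV : Module.finrank ℝ V = 2 * g) (L : Submodule ℝ V) (hL : Module.finrank ℝ L = g)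
   (iso : ∀ X ∈ L, ∀ Y ∈ L, ω X Y = 0) (X : V) (hX : ∀ Y ∈ L, ω Y X = 0) : X ∈ L := by
  have h1 : L ≤ ω.orthogonal L := fun x hx y hy => iso y hy x hx
  have h2 := LinearMap.BilinForm.finrank_orthogonal hn L
  have h3 : L = ω.orthogonal L := Submodule.eq_of_le_of_finrank_eq h1 (by omega)
  rw [h3]
  exact hX

theorem exists_complement {V : Type*} [AddCommGroup V] [Module ℝ V] [FiniteDimensional ℝ V] (L K : Submodule ℝ V)
   (h : K ≤ L) : ∃ C ≤ L, K ⊓ C = ⊥ ∧ Module.finrank ℝ K + Module.finrank ℝ C = Module.finrank ℝ L := by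
  obtain ⟨Q, hQ⟩ := Submodule.exists_isCompl K
  have h0 : K ⊓ (Q ⊓ L) = ⊥ := by
    rw [← inf_assoc, hQ.inf_eq_bot, bot_inf_eq]
  refine ⟨Q ⊓ L, inf_le_right, h0, ?_⟩
  have h1 : K ⊔ (Q ⊓ L) = L := by
    rw [← sup_inf_assoc_of_le Q h, hQ.sup_eq_top, top_inf_eq]
  have := Submodule.finrank_sup_add_finrank_inf_eq K (Q ⊓ L)
  rw [h1, h0, finrank_bot] at this
  omega

theorem exists_dual_families {V : Type*} [AddCommGroup V] [Module ℝ V] [FiniteDimensional ℝ V]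
   (ω : LinearMap.BilinForm ℝ V) (hω : ω.IsAlt) (hn : ω.Nondegenerate) {g : ℕ}
   (hV : Module.finrank ℝ V = 2 * g) (L₁ L₂ : Submodule ℝ V) (h₁ : Module.finrank ℝ L₁ = g)
   (h₂ : Module.finrank ℝ L₂ = g)
   (iso₁ : ∀ X ∈ L₁, ∀ Y ∈ L₁, ω X Y = 0) (iso₂ : ∀ X ∈ L₂, ∀ Y ∈ L₂, ω X Y = 0) {k : ℝ} (hk : k ≠ 0) :
   ∃ h : ℕ, h + Module.finrank ℝ (L₁ ⊓ L₂ : Submodule ℝ V) = g ∧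
    ∃ (v₁ : Fin h → L₁) (v₂ : Fin h → L₂),
      ∀ i j, k * ω (v₂ i) (v₁ j) = if i = j then 1 else 0 := by
  obtain ⟨C₁, hC₁, d₁, f₁⟩ := exists_complement L₁ (L₁ ⊓ L₂) inf_le_left
  obtain ⟨C₂, hC₂, d₂, f₂⟩ := exists_complement L₂ (L₁ ⊓ L₂) inf_le_right
  refine ⟨Module.finrank ℝ C₁, by omega, ?_⟩
  let b := Module.finBasis ℝ C₁
  let Φ : C₂ →ₗ[ℝ] (Fin (Module.finrank ℝ C₁) → ℝ) :=
    LinearMap.pi fun j => k • ((ω.flip (b j)).comp C₂.subtype)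
  have hΦ : ∀ c j, Φ c j = k * ω c (b j) := fun c j => rfl
  have inj : Function.Injective Φ := by
    rw [← LinearMap.ker_eq_bot, LinearMap.ker_eq_bot']
    intro c hc
    have h0 : ∀ y ∈ C₁, ω c y = 0 := by
      intro y hy
      have : (ω (c : V)).comp C₁.subtype = 0 := by
        refine b.ext fun j => ?_
        have := congrFun hc j
        rw [hΦ] at this
        simpa [hk] using this
      exact LinearMap.congr_fun this ⟨y, hy⟩
    have hC : (L₁ ⊓ L₂) ⊔ C₁ = L₁ := by
      refine Submodule.eq_of_le_of_finrank_eq (sup_le inf_le_left hC₁) ?_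
      have := Submodule.finrank_sup_add_finrank_inf_eq (L₁ ⊓ L₂) C₁
      rw [d₁, finrank_bot] at this
      omega
    have hm : (c : V) ∈ L₁ := by
      refine mem_of_forall_pairing_eq_zero ω hn hV L₁ h₁ iso₁ _ fun Y hY => ?_
      rw [← hC] at hY
      obtain ⟨y, hy, z, hz, rfl⟩ := Submodule.mem_sup.1 hY
      rw [map_add, LinearMap.add_apply, iso₂ y hy.2 c (hC₂ c.2), ← hω.neg_eq, h0 z hz]
      simp
    have : (c : V) ∈ (L₁ ⊓ L₂) ⊓ C₂ := ⟨⟨hm, hC₂ c.2⟩, c.2⟩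
    rw [d₂] at this
    exact Subtype.ext (by simpa using this)
  have surj : Function.Surjective Φ := by
    rw [← LinearMap.injective_iff_surjective_of_finrank_eq_finrank]
    · exact inj
    · rw [Module.finrank_fin_fun]; omega
  choose v hv using surj
  refine ⟨fun j => ⟨b j, hC₁ (b j).2⟩, fun i => ⟨v (Pi.single i 1), hC₂ (v _).2⟩, fun i j => ?_⟩
  have := congrFun (hv (Pi.single i 1)) j
  rw [hΦ] at this
  rw [this, Pi.single_apply]
  simp [eq_comm]

theorem exists_lattice_basis {V : Type*} [AddCommGroup V] [Module ℝ V] {n : ℕ}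
    (b : Module.Basis (Fin n) ℝ V) {Z : Submodule ℤ V}
    (hZ : Z = Submodule.span ℤ (Set.range b)) (L : Submodule ℝ V)
    (hL : Submodule.span ℝ ((L : Set V) ∩ Z) = L) :
    ∃ w : Fin (Module.finrank ℝ L) → V, LinearIndependent ℝ w ∧
      Submodule.span ℤ (Set.range w) = L.restrictScalars ℤ ⊓ Z := by
  subst hZ
  have h := finrank_span_int b (L.restrictScalars ℤ ⊓ _) inf_le_right
  have e : ((L.restrictScalars ℤ ⊓ Submodule.span ℤ (Set.range b) : Submodule ℤ V) : Set V) =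
    (L : Set V) ∩ Submodule.span ℤ (Set.range b) := rfl
  rw [e, hL] at h
  rw [h]
  exact exists_int_basis_of_le_span b _ inf_le_right

variable {g : ℕ} {V : Type*} [AddCommGroup V] [Module ℝ V]

theorem finrank_eq (𝒯 : SymplecticTorus g V) : Module.finrank ℝ V = 2 * g := by
  obtain ⟨b, -⟩ := 𝒯.isLattice
  simpa using Module.finrank_eq_card_basis b

theorem finiteDimensional (𝒯 : SymplecticTorus g V) : FiniteDimensional ℝ V := by
  obtain ⟨b, -⟩ := 𝒯.isLattice
  exact Module.Basis.finiteDimensional_of_finite b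

theorem skew (𝒯 : SymplecticTorus g V) (X Y : V) : 𝒯.ω X Y = - 𝒯.ω Y X :=
  (𝒯.isAlt.neg_eq Y X).symm

/-- The unit complex number `e ^ (π i k ω(X, Y))`. -/
noncomputable def mult (𝒯 : SymplecticTorus g V) (X Y : V) : Circle :=
  Circle.exp (Real.pi * (𝒯.k * 𝒯.ω X Y))

theorem mult_add_left (𝒯 : SymplecticTorus g V) (X X' Y : V) :
    𝒯.mult (X + X') Y = 𝒯.mult X Y * 𝒯.mult X' Y := by
  simp [mult, mul_add, Circle.exp_add]

theorem mult_add_right (𝒯 : SymplecticTorus g V) (X Y Y' : V) :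
    𝒯.mult X (Y + Y') = 𝒯.mult X Y * 𝒯.mult X Y' := by
  simp [mult, mul_add, Circle.exp_add]

theorem mult_sub_right (𝒯 : SymplecticTorus g V) (X Y Y' : V) :
    𝒯.mult X (Y - Y') = 𝒯.mult X Y * 𝒯.mult Y' X := by
  rw [mult, mult, mult, 𝒯.skew Y' X, ← Circle.exp_add]
  congr 1
  rw [map_sub]
  ring

theorem mult_mul_swap (𝒯 : SymplecticTorus g V) (X Y : V) : 𝒯.mult X Y * 𝒯.mult Y X = 1 := by
  rw [← mult_sub_right, sub_self, mult, map_zero]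
  simp

theorem mult_lattice (𝒯 : SymplecticTorus g V) {X Y : V} (hX : X ∈ 𝒯.Z) (hY : Y ∈ 𝒯.Z) :
    𝒯.mult X Y = 1 := by
  obtain ⟨n, hn⟩ := (𝒯.selfDual X).1 hX Y hY
  obtain ⟨m, hm⟩ := 𝒯.k_even
  rw [mult, hn, hm, Circle.exp_eq_one]
  exact ⟨m * n, by push_cast; ring⟩

/-! ### Invariant real polarizations, prequantum sections and the space of quantization -/

/-- An invariant real polarization: a Lagrangian subspace `L` that is rational, i.e. spanned by
its lattice points. -/
structure Polarization (𝒯 : SymplecticTorus g V) where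
  L : Submodule ℝ V
  isotropic : ∀ X ∈ L, ∀ Y ∈ L, 𝒯.ω X Y = 0
  finrank_L : Module.finrank ℝ L = g
  rational : Submodule.span ℝ ((L : Set V) ∩ 𝒯.Z) = L

namespace Polarization

variable {𝒯 : SymplecticTorus g V}

/-- The leaves in `V / Z` of the foliation by translates of `L`: the quotient `V / (L + Z)`. -/
abbrev Leaf (P : 𝒯.Polarization) : Type _ := V ⧸ (P.L.restrictScalars ℤ ⊔ 𝒯.Z)

/-- The leaf through the image of `X`. -/
abbrev leafOf (P : 𝒯.Polarization) (X : V) : P.Leaf := (P.L.restrictScalars ℤ ⊔ 𝒯.Z).mkQ X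

theorem leafOf_sub (P : 𝒯.Polarization) (X Y : V) :
    P.leafOf (X - Y) = P.leafOf X - P.leafOf Y := map_sub _ X Y

/-- The functions that represent (set-theoretic) sections over `V` of the pulled back prequantum
bundle `V × ℂ` tensored with the complex functions on `g`-tuples of vectors of `L`; half-densities
on `L` are functions of the latter kind. -/
abbrev Amplitude (P : 𝒯.Polarization) : Type _ := V → (Fin g → P.L) → ℂ

/-- A (complex valued) half-density on `L`. -/
def IsHalfDensity (P : 𝒯.Polarization) (ν : (Fin g → P.L) → ℂ) : Prop :=
  ∀ (a : P.L ≃ₗ[ℝ] P.L) (f : Fin g → P.L),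
    ν (fun i => a (f i)) = (Real.sqrt |LinearMap.det (a : P.L →ₗ[ℝ] P.L)| : ℂ) * ν f

/-- `S_Λ`: the covariantly constant sections over the leaf `Λ` of the tensor product of the
prequantum line bundle of `V / Z` with the half-densities of the polarization.
Sections over `Λ` are represented by functions on `V`, supported on the preimage of `Λ`, that are
invariant under the action `W • (X, z) = (X + W, e ^ (π i k ω(W, X)) z)` of the lattice on the
trivial line bundle over `V`, whose connection is `∇ = d - 2 π i k θ` with the symplectic potential
`θ_X(Y) = ω(X, Y) / 2`. -/
noncomputable def leafSections (P : 𝒯.Polarization) (Λ : P.Leaf) : Submodule ℂ P.Amplitude where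
  carrier := {ψ |
    (∀ X f, P.leafOf X ≠ Λ → ψ X f = 0) ∧
    (∀ X, P.IsHalfDensity (ψ X)) ∧
    (∀ W ∈ 𝒯.Z, ∀ X f, ψ (X + W) f = 𝒯.mult W X * ψ X f) ∧
    (∀ Y ∈ P.L, ∀ X f, HasDerivAt (fun t : ℝ => ψ (X + t • Y) f)
      (2 * Real.pi * Complex.I * 𝒯.k * (𝒯.ω X Y / 2 : ℝ) * ψ X f) 0)}
  zero_mem' := by
    refine ⟨fun _ _ _ => rfl, fun _ _ _ => by simp, fun _ _ _ _ => by simp, fun _ _ X f => ?_⟩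
    simpa using hasDerivAt_const (0 : ℝ) (0 : ℂ)
  add_mem' := by
    rintro ψ φ ⟨h1, h2, h3, h4⟩ ⟨h1', h2', h3', h4'⟩
    refine ⟨fun X f h => ?_, fun X a f => ?_, fun W hW X f => ?_, fun Y hY X f => ?_⟩
    · simp [h1 X f h, h1' X f h]
    · simp [h2 X a f, h2' X a f, mul_add]
    · simp [h3 W hW X f, h3' W hW X f, mul_add]
    · refine ((h4 Y hY X f).add (h4' Y hY X f)).congr_deriv ?_
      rw [← mul_add]
      rfl
  smul_mem' := by
    rintro c ψ ⟨h1, h2, h3, h4⟩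
    refine ⟨fun X f h => ?_, fun X a f => ?_, fun W hW X f => ?_, fun Y hY X f => ?_⟩
    · simp [h1 X f h]
    · simp [h2 X a f, mul_left_comm]
    · simp [h3 W hW X f, mul_left_comm]
    · refine ((h4 Y hY X f).const_mul c).congr_deriv ?_
      rw [mul_left_comm]
      rfl

/-- `Λ` is a Bohr–Sommerfeld leaf: over it the bundle is trivial as a line bundle with flat
connection, i.e. it has a nowhere vanishing covariantly constant section. -/
def IsBohrSommerfeld (P : 𝒯.Polarization) (Λ : P.Leaf) : Prop :=
  ∃ ψ ∈ P.leafSections Λ, ∀ X, P.leafOf X = Λ → ψ X ≠ 0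

/-- The space of quantization `H_P`, the direct sum of the spaces `S_Λ` over the Bohr–Sommerfeld
leaves (the sum is direct because the supports are disjoint). -/
noncomputable def quantization (P : 𝒯.Polarization) : Submodule ℂ P.Amplitude :=
  ⨆ (Λ : P.Leaf) (_ : P.IsBohrSommerfeld Λ), P.leafSections Λ

theorem exists_latticeBasis (P : 𝒯.Polarization) : ∃ b : Module.Basis (Fin g) ℝ P.L,
    Submodule.span ℤ (Set.range fun i => (b i : V)) = P.L.restrictScalars ℤ ⊓ 𝒯.Z := by
  obtain ⟨b, hb⟩ := 𝒯.isLattice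
  obtain ⟨w, hw, hs⟩ := exists_lattice_basis b hb P.L P.rational
  have hfd := 𝒯.finiteDimensional
  have hg := P.finrank_L
  have key : ∀ n, n = g → ∀ w : Fin n → V, LinearIndependent ℝ w →
      Submodule.span ℤ (Set.range w) = P.L.restrictScalars ℤ ⊓ 𝒯.Z →
      ∃ b : Module.Basis (Fin g) ℝ P.L,
        Submodule.span ℤ (Set.range fun i => (b i : V)) = P.L.restrictScalars ℤ ⊓ 𝒯.Z := by
    rintro n rfl w hw hs
    have hm : ∀ i, w i ∈ P.L := fun i =>
      (hs.le (Submodule.subset_span ⟨i, rfl⟩)).1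
    have hi : LinearIndependent ℝ (fun i => (⟨w i, hm i⟩ : P.L)) :=
      LinearIndependent.of_comp P.L.subtype hw
    refine ⟨Module.Basis.mk hi (hi.span_eq_top_of_card_eq_finrank' (by simp [hg])).ge, ?_⟩
    simpa using hs
  exact key _ hg w hw hs

/-- A basis of the lattice `L ∩ Z`, as a real basis of `L`. -/
noncomputable def latticeBasis (P : 𝒯.Polarization) : Module.Basis (Fin g) ℝ P.L :=
  P.exists_latticeBasis.choose

/-- The inner product on `H_P` (conjugate linear in the first variable): the sum over the leaves
`Λ` of the integrals over `Λ` of the density `(s, s') μ * μ'`. With a point `X` over `Λ` and a basis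
`b` of `L ∩ Z`, the map `t ↦ X + ∑ i, t i • b i` parametrizes the torus `Λ` by the unit cube, and
the integral of a density is that of its value on the frame `b`. Both sections vanish outside the
finitely many Bohr–Sommerfeld leaves. -/
noncomputable def innerProd (P : 𝒯.Polarization) (ψ φ : P.Amplitude) : ℂ :=
  ∑ᶠ Λ : P.Leaf, ∫ t in Set.Icc (0 : Fin g → ℝ) 1,
    (starRingEnd ℂ) (ψ (Quotient.out Λ + ∑ i, t i • (P.latticeBasis i : V)) P.latticeBasis) *
      φ (Quotient.out Λ + ∑ i, t i • (P.latticeBasis i : V)) P.latticeBasis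

/-! ### The Blattner–Kostant–Sternberg pairing -/

/-- Frames `(V₂, W; V₁, T)` of `V` adapted to two polarizations: `(V₁, W)` is a basis of `L₁`,
`(V₂, W)` is a basis of `L₂`, and `W` is a basis of `L₁ ∩ L₂`, chosen to be moreover a basis of
the lattice `L₁ ∩ L₂ ∩ Z`; the remaining pairings are normalized by the symplectic form `k ω`. -/
structure PairingFrame (P₂ P₁ : 𝒯.Polarization) where
  h : ℕ
  d : ℕ
  h_add_d : h + d = g
  finrank_inf : Module.finrank ℝ (P₁.L ⊓ P₂.L : Submodule ℝ V) = d
  V₁ : Fin h → P₁.L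
  V₂ : Fin h → P₂.L
  W : Fin d → (P₁.L ⊓ P₂.L : Submodule ℝ V)
  T : Fin d → V
  span_W : Submodule.span ℤ (Set.range fun i => (W i : V)) =
    (P₁.L ⊓ P₂.L).restrictScalars ℤ ⊓ 𝒯.Z
  linearIndependent : LinearIndependent ℝ
    (Sum.elim (Sum.elim (fun i => (V₂ i : V)) (fun i => (W i : V)))
      (Sum.elim (fun i => (V₁ i : V)) T))
  pair_W_T : ∀ i j, 𝒯.k * 𝒯.ω (W i) (T j) = if i = j then 1 else 0
  pair_V₂_V₁ : ∀ i j, 𝒯.k * 𝒯.ω (V₂ i) (V₁ j) = if i = j then 1 else 0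
  pair_V₁_T : ∀ i j, 𝒯.k * 𝒯.ω (V₁ i) (T j) = 0
  pair_V₂_T : ∀ i j, 𝒯.k * 𝒯.ω (V₂ i) (T j) = 0

namespace PairingFrame

variable {P₂ P₁ : 𝒯.Polarization}

/-- The frame `U₁ = (V₁, W)` of `L₁`. -/
def U₁ (Φ : PairingFrame P₂ P₁) : Fin g → P₁.L := fun i =>
  Fin.append Φ.V₁ (fun j => ⟨Φ.W j, (Φ.W j).2.1⟩) (Fin.cast Φ.h_add_d.symm i)

/-- The frame `U₂ = (V₂, W)` of `L₂`. -/
def U₂ (Φ : PairingFrame P₂ P₁) : Fin g → P₂.L := fun i =>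
  Fin.append Φ.V₂ (fun j => ⟨Φ.W j, (Φ.W j).2.2⟩) (Fin.cast Φ.h_add_d.symm i)

theorem nonempty (P₂ P₁ : 𝒯.Polarization) : Nonempty (PairingFrame P₂ P₁) := by
  have hfd := 𝒯.finiteDimensional
  have hk : (𝒯.k : ℝ) ≠ 0 := by exact_mod_cast 𝒯.k_pos.ne'
  obtain ⟨b, hb⟩ := 𝒯.isLattice
  obtain ⟨w, hw, hs⟩ := exists_lattice_basis b hb (P₁.L ⊓ P₂.L)
    (rational_inf b 𝒯.Z hb _ _ P₁.rational P₂.rational)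
  obtain ⟨h, hd, v₁, v₂, h21⟩ := exists_dual_families 𝒯.ω 𝒯.isAlt 𝒯.nondegenerate 𝒯.finrank_eq
    P₁.L P₂.L P₁.finrank_L P₂.finrank_L P₁.isotropic P₂.isotropic hk
  have hm : ∀ i, w i ∈ P₁.L ⊓ P₂.L := fun i =>
    (hs.le (Submodule.subset_span ⟨i, rfl⟩)).1
  have h11 : ∀ i j, 𝒯.ω (v₁ i) (v₁ j) = 0 := fun i j => P₁.isotropic _ (v₁ i).2 _ (v₁ j).2
  have h22 : ∀ i j, 𝒯.ω (v₂ i) (v₂ j) = 0 := fun i j => P₂.isotropic _ (v₂ i).2 _ (v₂ j).2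
  have h1w : ∀ i j, 𝒯.ω (v₁ i) (w j) = 0 := fun i j => P₁.isotropic _ (v₁ i).2 _ (hm j).1
  have h2w : ∀ i j, 𝒯.ω (v₂ i) (w j) = 0 := fun i j => P₂.isotropic _ (v₂ i).2 _ (hm j).2
  have hww : ∀ i j, 𝒯.ω (w i) (w j) = 0 := fun i j => P₁.isotropic _ (hm i).1 _ (hm j).1
  have li : LinearIndependent ℝ (Sum.elim (Sum.elim (fun i => (v₂ i : V)) w)
      (Sum.elim (fun i => (v₁ i : V)) (fun i : Fin 0 => (0 : V)))) :=
    linearIndependent_of_pairing 𝒯.ω 𝒯.isAlt (k := 𝒯.k) _ _ w (fun i : Fin 0 => (0 : V))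
      (fun i : Fin 0 => i.elim0) (fun i => i.elim0) hw h11 h22 h1w h2w hww h21
      (fun _ j => j.elim0) (fun _ j => j.elim0) (fun _ j => j.elim0)
  have hT : ∀ j, ∃ T : V, (∀ i, 𝒯.ω (w i) T = if i = j then (𝒯.k : ℝ)⁻¹ else 0) ∧
      (∀ i, 𝒯.ω (v₁ i) T = 0) ∧ (∀ i, 𝒯.ω (v₂ i) T = 0) := by
    intro j
    obtain ⟨T, hT⟩ := exists_pairing_eq 𝒯.ω 𝒯.nondegenerate _ li
      (Sum.elim (Sum.elim (fun _ => 0) (fun i => if i = j then (𝒯.k : ℝ)⁻¹ else 0))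
        (fun _ => 0))
    exact ⟨T, fun i => hT (.inl (.inr i)), fun i => hT (.inr (.inl i)),
      fun i => hT (.inl (.inl i))⟩
  choose T hwT h1T h2T using hT
  have hwT' : ∀ i j, (𝒯.k : ℝ) * 𝒯.ω (w i) (T j) = if i = j then 1 else 0 := by
    intro i j
    rw [hwT]
    split_ifs <;> simp [hk]
  exact ⟨{ h := h, d := _, h_add_d := hd, finrank_inf := rfl, V₁ := v₁, V₂ := v₂
           W := fun i => ⟨w i, hm i⟩, T := T, span_W := hs
           linearIndependent := linearIndependent_of_pairing 𝒯.ω 𝒯.isAlt (k := 𝒯.k) _ _ w T id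
             Function.injective_id hw h11 h22 h1w h2w hww h21 hwT' (fun i j => h1T j i)
             (fun i j => h2T j i)
           pair_W_T := hwT', pair_V₂_V₁ := h21
           pair_V₁_T := fun i j => by rw [h1T, mul_zero]
           pair_V₂_T := fun i j => by rw [h2T, mul_zero] }⟩

end PairingFrame

/-- A choice of adapted frames; the pairing below does not depend on it. -/
noncomputable def pairingFrame (P₂ P₁ : 𝒯.Polarization) : PairingFrame P₂ P₁ :=
  Classical.choice (PairingFrame.nonempty P₂ P₁)

/-- The Blattner–Kostant–Sternberg pairing: the sum, over the connected components of the
intersections `Λ₂ ∩ Λ₁` of leaves, of the integrals of the density `(s₂, s₁) μ₂ * μ₁`, where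
`(μ₂ * μ₁)(W) = μ₂(V₂, W) μ₁(V₁, W)`. The components are the translates in `V / Z` of the image of
`L₁ ∩ L₂`; the one through the image of `X` is parametrized by the unit cube through
`t ↦ X + ∑ i, t i • W i`. The two sections vanish outside the Bohr–Sommerfeld leaves, so that only
finitely many components contribute. -/
noncomputable def bksPairing (P₂ P₁ : 𝒯.Polarization) (ψ₂ : P₂.Amplitude) (ψ₁ : P₁.Amplitude) :
    ℂ :=
  ∑ᶠ C : V ⧸ ((P₁.L ⊓ P₂.L).restrictScalars ℤ ⊔ 𝒯.Z),
    ∫ t in Set.Icc (0 : Fin (pairingFrame P₂ P₁).d → ℝ) 1,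
      (starRingEnd ℂ) (ψ₂ (Quotient.out C + ∑ i, t i • ((pairingFrame P₂ P₁).W i : V))
        (pairingFrame P₂ P₁).U₂) *
      ψ₁ (Quotient.out C + ∑ i, t i • ((pairingFrame P₂ P₁).W i : V)) (pairingFrame P₂ P₁).U₁

/-- `F` is the operator `H_{P₁} → H_{P₂}` induced by the pairing:
`⟨ψ₂, F ψ₁⟩ = ⟨⟨ψ₂, ψ₁⟩⟩` for all `ψ₁`, `ψ₂`. -/
def IsBKSOperator (P₂ P₁ : 𝒯.Polarization) (F : P₁.quantization →ₗ[ℂ] P₂.quantization) : Prop :=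
  ∀ (ψ₁ : P₁.quantization) (ψ₂ : P₂.quantization),
    P₂.innerProd ψ₂ (F ψ₁) = bksPairing P₂ P₁ ψ₂ ψ₁

end Polarization

/-! ### The Heisenberg group -/

/-- The lattice `(1 / k) Z`. -/
def fracLattice (𝒯 : SymplecticTorus g V) : Submodule ℤ V where
  carrier := {X | (𝒯.k : ℤ) • X ∈ 𝒯.Z}
  zero_mem' := by simp
  add_mem' := by
    intro X Y hX hY
    simpa [smul_add] using 𝒯.Z.add_mem hX hY
  smul_mem' := by
    intro c X hX
    change (𝒯.k : ℤ) • c • X ∈ 𝒯.Z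
    rw [smul_comm]
    exact 𝒯.Z.smul_mem c hX

/-- The vector `(1 / k) W`, for `W` in the lattice `Z`. -/
noncomputable def divLevel (𝒯 : SymplecticTorus g V) (W : 𝒯.Z) : 𝒯.fracLattice :=
  ⟨(𝒯.k : ℝ)⁻¹ • (W : V), by
    have hk : (𝒯.k : ℝ) ≠ 0 := by exact_mod_cast 𝒯.k_pos.ne'
    have : (𝒯.k : ℤ) • (𝒯.k : ℝ)⁻¹ • (W : V) = W := by
      rw [← Int.cast_smul_eq_zsmul ℝ, smul_smul]
      simp [hk]
    change (𝒯.k : ℤ) • (𝒯.k : ℝ)⁻¹ • (W : V) ∈ 𝒯.Z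
    rw [this]
    exact W.2⟩

/-- `e ^ (2 π i k ω(X, Y)) = 1` for `X` in `(1 / k) Z` and `Y` in `Z`. -/
theorem mult_frac_comm (𝒯 : SymplecticTorus g V) {X Y : V} (hX : X ∈ 𝒯.fracLattice)
    (hY : Y ∈ 𝒯.Z) : 𝒯.mult X Y = 𝒯.mult Y X := by
  obtain ⟨n, hn⟩ := (𝒯.selfDual _).1 (show (𝒯.k : ℤ) • X ∈ 𝒯.Z from hX) Y hY
  rw [map_zsmul, LinearMap.smul_apply, zsmul_eq_mul, Int.cast_natCast] at hn
  have h2 : 𝒯.mult X Y * 𝒯.mult X Y = 1 := by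
    rw [mult, hn, ← Circle.exp_add, Circle.exp_eq_one]
    exact ⟨n, by ring⟩
  have h3 := 𝒯.mult_mul_swap X Y
  exact mul_left_cancel (h2.trans h3.symm)

/-- The set `𝕋 × (1 / k) Z` with the law
`(z, X) (z', X') = (z z' e ^ (π i k ω(X, X')), X + X')`. -/
@[ext]
structure PreHeisenberg (𝒯 : SymplecticTorus g V) where
  phase : Circle
  vec : 𝒯.fracLattice

namespace PreHeisenberg

variable {𝒯 : SymplecticTorus g V}

noncomputable instance : Group 𝒯.PreHeisenberg where
  mul x y := ⟨x.phase * y.phase * 𝒯.mult x.vec y.vec, x.vec + y.vec⟩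
  one := ⟨1, 0⟩
  inv x := ⟨x.phase⁻¹, -x.vec⟩
  mul_assoc x y z := by
    refine PreHeisenberg.ext ?_ (add_assoc _ _ _)
    change x.phase * y.phase * 𝒯.mult x.vec y.vec * z.phase *
      𝒯.mult ((x.vec + y.vec : 𝒯.fracLattice) : V) z.vec =
      x.phase * (y.phase * z.phase * 𝒯.mult y.vec z.vec) *
      𝒯.mult x.vec ((y.vec + z.vec : 𝒯.fracLattice) : V)
    rw [Submodule.coe_add, Submodule.coe_add, mult_add_left, mult_add_right]
    simp only [mul_comm, mul_left_comm, mul_assoc]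
  one_mul x := by
    refine PreHeisenberg.ext ?_ (zero_add _)
    change 1 * x.phase * 𝒯.mult ((0 : 𝒯.fracLattice) : V) x.vec = x.phase
    simp [mult]
  mul_one x := by
    refine PreHeisenberg.ext ?_ (add_zero _)
    change x.phase * 1 * 𝒯.mult x.vec ((0 : 𝒯.fracLattice) : V) = x.phase
    simp [mult]
  inv_mul_cancel x := by
    refine PreHeisenberg.ext ?_ (neg_add_cancel _)
    change x.phase⁻¹ * x.phase * 𝒯.mult ((-x.vec : 𝒯.fracLattice) : V) x.vec = 1
    have : 𝒯.ω x.vec x.vec = 0 := 𝒯.isAlt _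
    simp [mult, this]

theorem mul_phase (x y : 𝒯.PreHeisenberg) :
    (x * y).phase = x.phase * y.phase * 𝒯.mult x.vec y.vec := rfl

theorem mul_vec (x y : 𝒯.PreHeisenberg) : (x * y).vec = x.vec + y.vec := rfl

end PreHeisenberg

/-- The central subgroup of the elements `(1, W)` with `W` in `Z`. -/
noncomputable def latticeSubgroup (𝒯 : SymplecticTorus g V) : Subgroup 𝒯.PreHeisenberg where
  carrier := {x | x.phase = 1 ∧ (x.vec : V) ∈ 𝒯.Z}
  one_mem' := ⟨rfl, 𝒯.Z.zero_mem⟩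
  mul_mem' := by
    rintro x y ⟨hx, hx'⟩ ⟨hy, hy'⟩
    refine ⟨?_, 𝒯.Z.add_mem hx' hy'⟩
    rw [PreHeisenberg.mul_phase, hx, hy, 𝒯.mult_lattice hx' hy']
    simp
  inv_mem' := by
    rintro x ⟨hx, hx'⟩
    refine ⟨?_, 𝒯.Z.neg_mem hx'⟩
    change x.phase⁻¹ = 1
    rw [hx, inv_one]

theorem lattice_central (𝒯 : SymplecticTorus g V) {x : 𝒯.PreHeisenberg}
    (hx : x ∈ 𝒯.latticeSubgroup) (y : 𝒯.PreHeisenberg) : y * x = x * y := by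
  refine PreHeisenberg.ext ?_ (add_comm _ _)
  rw [PreHeisenberg.mul_phase, PreHeisenberg.mul_phase, 𝒯.mult_frac_comm y.vec.2 hx.2,
    mul_comm y.phase]

instance (𝒯 : SymplecticTorus g V) : 𝒯.latticeSubgroup.Normal where
  conj_mem x hx y := by
    rw [𝒯.lattice_central hx y, mul_inv_cancel_right]
    exact hx

/-- The finite Heisenberg group `H_k`. -/
abbrev Heisenberg (𝒯 : SymplecticTorus g V) : Type _ := 𝒯.PreHeisenberg ⧸ 𝒯.latticeSubgroup

/-- The class in `H_k` of `(z, X)`, for `z` in the circle and `X` in `(1 / k) Z`. -/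
noncomputable def heis (𝒯 : SymplecticTorus g V) (z : Circle) (X : 𝒯.fracLattice) : 𝒯.Heisenberg :=
  QuotientGroup.mk ⟨z, X⟩

/-- The inclusion of the circle in `H_k`. -/
noncomputable def circleInclusion (𝒯 : SymplecticTorus g V) : Circle →* 𝒯.Heisenberg where
  toFun z := 𝒯.heis z 0
  map_one' := rfl
  map_mul' z z' := by
    refine congrArg QuotientGroup.mk (PreHeisenberg.ext ?_ (zero_add _).symm)
    rw [PreHeisenberg.mul_phase]
    simp [mult]

/-- The group `Z_k = ((1 / k) Z) / Z`. -/
abbrev Zk (𝒯 : SymplecticTorus g V) : Type _ :=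
  𝒯.fracLattice ⧸ (𝒯.Z.comap 𝒯.fracLattice.subtype)

/-- The projection of `H_k` to `Z_k`. -/
noncomputable def projection (𝒯 : SymplecticTorus g V) : 𝒯.Heisenberg →* Multiplicative 𝒯.Zk :=
  QuotientGroup.lift 𝒯.latticeSubgroup
    { toFun := fun x => Multiplicative.ofAdd (Submodule.Quotient.mk x.vec)
      map_one' := rfl
      map_mul' := fun _ _ => rfl }
    (by
      intro x hx
      exact congrArg Multiplicative.ofAdd ((Submodule.Quotient.mk_eq_zero _).2 hx.2))

/-! ### The representation of the Heisenberg group -/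

namespace Polarization

variable {𝒯 : SymplecticTorus g V}

/-- The action on sections of the lift to the line bundle of the translations: the vector `X'` acts
by `(X' • s)(X) = X' • s(X - X')`, where `X' • (X, z) = (X + X', e ^ (π i k ω(X', X)) z)`, and
leaves the constant half-densities unchanged; the circle acts by scalars. -/
noncomputable def translation (P : 𝒯.Polarization) :
    Representation ℂ 𝒯.PreHeisenberg P.Amplitude where
  toFun x :=
    { toFun := fun ψ X f => x.phase * (𝒯.mult x.vec (X - x.vec) * ψ (X - x.vec) f)
      map_add' := fun ψ φ => by
        funext X f
        simp [mul_add]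
      map_smul' := fun c ψ => by
        funext X f
        simp [mul_left_comm] }
  map_one' := by
    refine LinearMap.ext fun ψ => ?_
    funext X f
    change ((1 : Circle) : ℂ) * (𝒯.mult ((0 : 𝒯.fracLattice) : V) (X - ((0 : 𝒯.fracLattice) : V)) *
      ψ (X - ((0 : 𝒯.fracLattice) : V)) f) = ψ X f
    simp [mult]
  map_mul' x y := by
    refine LinearMap.ext fun ψ => ?_
    funext X f
    change ((x * y).phase : ℂ) * (𝒯.mult (x * y).vec (X - (x * y).vec) *
      ψ (X - (x * y).vec) f) = x.phase * (𝒯.mult x.vec (X - x.vec) *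
      (y.phase * (𝒯.mult y.vec (X - x.vec - y.vec) * ψ (X - x.vec - y.vec) f)))
    have h1 : 𝒯.mult (x * y).vec (X - (x * y).vec) * 𝒯.mult x.vec y.vec =
        𝒯.mult x.vec (X - x.vec) * 𝒯.mult y.vec (X - x.vec - y.vec) := by
      rw [PreHeisenberg.mul_vec, Submodule.coe_add, ← sub_sub, mult_add_left,
        𝒯.mult_sub_right x.vec (X - x.vec) y.vec]
      rw [mul_right_comm, mul_assoc (𝒯.mult x.vec (X - x.vec)), 𝒯.mult_mul_swap, mul_one]
    have h2 : X - ((x * y).vec : V) = X - x.vec - y.vec := by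
      rw [PreHeisenberg.mul_vec, Submodule.coe_add, ← sub_sub]
    have h3 := congrArg (fun z : Circle => (z : ℂ)) h1
    simp only [Circle.coe_mul] at h3
    rw [PreHeisenberg.mul_phase, Circle.coe_mul, Circle.coe_mul]
    rw [show ((x.phase : ℂ) * y.phase * 𝒯.mult x.vec y.vec) *
        (𝒯.mult (x * y).vec (X - (x * y).vec) * ψ (X - (x * y).vec) f) =
        x.phase * y.phase * ((𝒯.mult (x * y).vec (X - (x * y).vec) * 𝒯.mult x.vec y.vec) *
          ψ (X - (x * y).vec) f) by ring, h3, h2]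
    ring

theorem translation_apply (P : 𝒯.Polarization) (x : 𝒯.PreHeisenberg) (ψ : P.Amplitude) (X : V)
    (f : Fin g → P.L) : P.translation x ψ X f =
      x.phase * (𝒯.mult x.vec (X - x.vec) * ψ (X - x.vec) f) := rfl

theorem translation_leafSections (P : 𝒯.Polarization) (x : 𝒯.PreHeisenberg) {Λ : P.Leaf}
    {ψ : P.Amplitude} (hψ : ψ ∈ P.leafSections Λ) :
    P.translation x ψ ∈ P.leafSections (Λ + P.leafOf x.vec) := by
  obtain ⟨h1, h2, h3, h4⟩ := hψ
  refine ⟨fun X f h => ?_, fun X a f => ?_, fun W hW X f => ?_, fun Y hY X f => ?_⟩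
  · rw [translation_apply, h1 _ _ (fun h' => h ?_), mul_zero, mul_zero]
    rw [← h', leafOf_sub, sub_add_cancel]
  · simp only [translation_apply]
    rw [h2 _ a f]
    ring
  · simp only [translation_apply]
    rw [show X + W - (x.vec : V) = X - x.vec + W by abel, h3 W hW, 𝒯.mult_add_right]
    have e1 : 𝒯.mult W X = 𝒯.mult W (X - x.vec) * 𝒯.mult x.vec W := by
      have e2 := 𝒯.mult_mul_swap W x.vec
      rw [← 𝒯.mult_frac_comm x.vec.2 hW] at e2
      rw [𝒯.mult_sub_right, mul_assoc, e2, mul_one]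
    rw [e1, Circle.coe_mul, Circle.coe_mul]
    ring
  · have hm : HasDerivAt (fun t : ℝ => (𝒯.mult x.vec (X + t • Y - x.vec) : ℂ))
        (2 * Real.pi * Complex.I * 𝒯.k * (𝒯.ω x.vec Y / 2 : ℝ) * 𝒯.mult x.vec (X - x.vec)) 0 := by
      have e (t : ℝ) : (𝒯.mult x.vec (X + t • Y - x.vec) : ℂ) = 𝒯.mult x.vec (X - x.vec) *
          Complex.exp (t * (Real.pi * 𝒯.k * 𝒯.ω x.vec Y * Complex.I)) := by
        rw [show X + t • Y - (x.vec : V) = X - x.vec + t • Y by abel, mult_add_right,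
          Circle.coe_mul, show 𝒯.mult x.vec (t • Y) =
            Circle.exp (Real.pi * (𝒯.k * 𝒯.ω x.vec (t • Y))) from rfl, Circle.coe_exp, map_smul, smul_eq_mul]
        congr 2
        push_cast
        ring
      have h0 := (((hasDerivAt_id (0 : ℝ)).ofReal_comp.mul_const
        (Real.pi * 𝒯.k * 𝒯.ω x.vec Y * Complex.I)).cexp).const_mul
          (𝒯.mult x.vec (X - x.vec) : ℂ)
      refine (h0.congr_of_eventuallyEq (Filter.Eventually.of_forall e)).congr_deriv ?_
      simp
      ring
    have hs := h4 Y hY (X - x.vec) f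
    have h5 : HasDerivAt (fun t : ℝ => ψ (X + t • Y - x.vec) f)
        (2 * Real.pi * Complex.I * 𝒯.k * (𝒯.ω (X - x.vec) Y / 2 : ℝ) * ψ (X - x.vec) f) 0 := by
      refine hs.congr_of_eventuallyEq (Filter.Eventually.of_forall fun t => ?_)
      change ψ (X + t • Y - x.vec) f = ψ (X - x.vec + t • Y) f
      rw [show X + t • Y - (x.vec : V) = X - x.vec + t • Y by abel]
    refine ((hm.mul h5).const_mul (x.phase : ℂ)).congr_deriv ?_
    rw [translation_apply, map_sub, LinearMap.sub_apply]
    simp only [zero_smul, add_zero]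
    push_cast
    ring

theorem translation_quantization (P : 𝒯.Polarization) (x : 𝒯.PreHeisenberg) :
    ∀ ψ ∈ P.quantization, P.translation x ψ ∈ P.quantization := by
  change P.quantization ≤ P.quantization.comap (P.translation x)
  refine iSup₂_le fun Λ hΛ ψ hψ => ?_
  have hBS : P.IsBohrSommerfeld (Λ + P.leafOf x.vec) := by
    obtain ⟨φ, hφ, hne⟩ := hΛ
    refine ⟨_, P.translation_leafSections x hφ, fun X hX h => ?_⟩
    refine hne (X - x.vec) (by rw [leafOf_sub, hX, add_sub_cancel_right]) ?_
    funext f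
    have := congrFun h f
    rw [translation_apply] at this
    simpa using this
  exact (le_iSup₂ (f := fun Λ (_ : P.IsBohrSommerfeld Λ) => P.leafSections Λ) _ hBS)
    (P.translation_leafSections x hψ)

theorem translation_lattice (P : 𝒯.Polarization) {x : 𝒯.PreHeisenberg}
    (hx : x ∈ 𝒯.latticeSubgroup) : ∀ ψ ∈ P.quantization, P.translation x ψ = ψ := by
  change P.quantization ≤ LinearMap.eqLocus (P.translation x) LinearMap.id
  refine iSup₂_le fun Λ hΛ ψ hψ => ?_
  change P.translation x ψ = ψ
  funext X f
  have h := hψ.2.2.1 x.vec hx.2 (X - x.vec) f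
  rw [sub_add_cancel] at h
  rw [translation_apply, ← h, hx.1]
  simp

/-- The representation of the Heisenberg group `H_k` on `H_P`. -/
noncomputable def heisenbergRep (P : 𝒯.Polarization) :
    Representation ℂ 𝒯.Heisenberg P.quantization :=
  QuotientGroup.lift 𝒯.latticeSubgroup
    { toFun := fun x => (P.translation x).restrict (P.translation_quantization x)
      map_one' := by
        ext ψ
        simp
      map_mul' := fun x y => by
        refine LinearMap.ext fun ψ => Subtype.ext ?_
        change P.translation (x * y) ψ = P.translation x (P.translation y ψ)
        rw [map_mul]
        rfl }
    (fun x hx => LinearMap.ext fun ψ => Subtype.ext (P.translation_lattice hx ψ ψ.2))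

/-! ### Adapted symplectic bases and standard unitary bases -/

/-- A symplectic basis `(W₁, …, W_g; W₁⊥, …, W_g⊥)` of `V` that is a basis of the lattice `Z` and
such that `W₁, …, W_g` span `L`. -/
structure AdaptedBasis (P : 𝒯.Polarization) where
  W : Fin g → 𝒯.Z
  Wp : Fin g → 𝒯.Z
  span_Z : Submodule.span ℤ (Set.range (fun i => (W i : V)) ∪ Set.range (fun i => (Wp i : V))) =
    𝒯.Z
  span_L : Submodule.span ℝ (Set.range fun i => (W i : V)) = P.L
  pair_W_Wp : ∀ i j, 𝒯.ω (W i) (Wp j) = if i = j then 1 else 0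
  pair_W_W : ∀ i j, 𝒯.ω (W i) (W j) = 0
  pair_Wp_Wp : ∀ i j, 𝒯.ω (Wp i) (Wp j) = 0

namespace AdaptedBasis

variable {P : 𝒯.Polarization}

/-- The function `K` with `K 0 = 0` and `d K = θ_P - θ`, where `θ_X(Y) = ω(X, Y) / 2` and `θ_P` is
the symplectic potential that vanishes on the `W i` and takes the value `ω(X, Wp i)` at `X` on
`Wp i`: if `X = ∑ i, a i • W i + ∑ i, b i • Wp i`, then `K X = (1 / 2) ∑ i, a i * b i`. -/
noncomputable def potential (B : P.AdaptedBasis) (X : V) : ℝ :=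
  (1 / 2) * ∑ i, 𝒯.ω X (B.Wp i) * 𝒯.ω (B.W i) X

/-- The half-density `δ` on `L` with `δ(W₁, …, W_g) = 1`. -/
noncomputable def delta (B : P.AdaptedBasis) (f : Fin g → P.L) : ℝ :=
  Real.sqrt |(Matrix.of fun i j => 𝒯.ω (f j) (B.Wp i)).det|

open Classical in
/-- The section `σ_q = s_q ⊗ δ_q` supported on the leaf `Λ_q`, whose points are the `X` with
`k ω(W i, X) = q i mod k` for all `i`; there, `s_q(X) = e ^ (- 2 π i k K(X))`. -/
noncomputable def standardSection (B : P.AdaptedBasis) (q : Fin g → ZMod 𝒯.k) : P.Amplitude :=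
  fun X f =>
    if ∀ i, ∃ l : ℤ, 𝒯.k * 𝒯.ω (B.W i) X = ((q i).val : ℝ) + 𝒯.k * l then
      Complex.exp (- (2 * Real.pi * Complex.I * 𝒯.k * B.potential X)) * B.delta f
    else 0

end AdaptedBasis

end Polarization

end SymplecticTorus

namespace SymplecticTorus

variable {g : ℕ} {V : Type*} [AddCommGroup V] [Module ℝ V]

/-! ### The extension `1 → 𝕋 → H_k → Z_k → 0` -/

/-! Everything rests on the two quasi-periodicities of a flat section: translation by `Y ∈ L`
multiplies it by `mult X Y` (parallel transport), translation by `W ∈ Z` by `mult W X`. For `W ∈ L ∩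
Z` both rules apply, so a nonzero value at `X` forces `e ^ (2 π i k ω(W, X)) = 1`: flat sections
live over the Bohr–Sommerfeld leaves (`mem_bsPoints_of_ne_zero`). In an adapted basis these are the
leaves `k ω(W i, X) ≡ q i mod k`. Over each of them a flat section is determined by its value at one
point and one frame (`eq_sum_standardSection`), and the explicit `σ_q` exists because `k` is even
(`osc_add_lattice`). The formulas for the action are then computations with the quadratic function
`K`.

Adapted bases exist because `L ∩ Z` is a direct summand of `Z` and self-duality realizes every
integral functional on `Z` by a lattice vector (`adaptedBasis_nonempty`).

For flat sections of two polarizations the product `conj ψ₂ * ψ₁` is invariant under `(L₁ ∩ L₂) +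
Z`, since the unimodular factors cancel (`leafInvariant_pairing`). The integrals over unit cubes
thus reduce to values at representatives, and both the inner product and the pairing become sums
over classes modulo `K + Z`, with `K = L` or `K = L₁ ∩ L₂`. A Heisenberg element multiplies both
sections by the same phase and permutes the classes, so both forms are invariant
(`leafSum_translation`). Rationality of the polarizations makes the sums finite (`finite_bsLeaves`),
hence the forms sesquilinear.

The orthonormal basis makes the inner product nondegenerate, so the pairing is represented by
exactly one operator. This operator intertwines because both forms are invariant. -/

theorem circleInclusion_injective (𝒯 : SymplecticTorus g V) :
    Function.Injective 𝒯.circleInclusion := by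
  intro z z' h
  have h1 : (⟨z, 0⟩ : 𝒯.PreHeisenberg)⁻¹ * ⟨z', 0⟩ ∈ 𝒯.latticeSubgroup := QuotientGroup.eq.1 h
  have h2 : z⁻¹ * z' * 𝒯.mult ((-0 : 𝒯.fracLattice) : V) ((0 : 𝒯.fracLattice) : V) = 1 := h1.1
  simp only [mult, neg_zero, ZeroMemClass.coe_zero, map_zero, mul_zero, Circle.exp_zero,
    mul_one] at h2
  exact inv_mul_eq_one.1 h2

theorem projection_surjective (𝒯 : SymplecticTorus g V) : Function.Surjective 𝒯.projection := by
  intro y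
  obtain ⟨x, hx⟩ := Submodule.Quotient.mk_surjective _ (Multiplicative.toAdd y)
  exact ⟨𝒯.heis 1 x, congrArg Multiplicative.ofAdd hx⟩

theorem range_circleInclusion (𝒯 : SymplecticTorus g V) :
    𝒯.circleInclusion.range = 𝒯.projection.ker := by
  ext x
  constructor
  · rintro ⟨z, rfl⟩
    exact congrArg Multiplicative.ofAdd (Submodule.Quotient.mk_zero _)
  · induction x using QuotientGroup.induction_on with
    | H x =>
      intro hx
      have hx' : (Submodule.Quotient.mk x.vec : 𝒯.Zk) = 0 := hx
      have hm : (x.vec : V) ∈ 𝒯.Z := (Submodule.Quotient.mk_eq_zero (𝒯.Z.comap 𝒯.fracLattice.subtype)).1 hx'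
      -- For `W` in `Z`, the elements `(λ, W)` and `(λ, 0)` differ by `(1, W)`, which is trivial in
      -- `H_k`.
      refine ⟨x.phase, QuotientGroup.eq.2 ⟨?_, ?_⟩⟩
      · change x.phase⁻¹ * x.phase * 𝒯.mult ((-0 : 𝒯.fracLattice) : V) x.vec = 1
        simp [mult]
      · change ((-0 + x.vec : 𝒯.fracLattice) : V) ∈ 𝒯.Z
        simpa using hm

theorem range_circleInclusion_le_center (𝒯 : SymplecticTorus g V) :
    𝒯.circleInclusion.range ≤ Subgroup.center 𝒯.Heisenberg := by
  rintro _ ⟨z, rfl⟩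
  rw [Subgroup.mem_center_iff]
  intro y
  induction y using QuotientGroup.induction_on with
  | H y =>
    refine congrArg QuotientGroup.mk (PreHeisenberg.ext ?_ (add_comm _ _))
    rw [PreHeisenberg.mul_phase, PreHeisenberg.mul_phase]
    simp [mult, mul_comm]

/-! ### Sums over leaves -/

/-- The two multipliers are inverse to each other, so they agree exactly when `e ^ (2 π i k ω(X, Y))
= 1`. Applied to a lattice vector of `L`, this is the Bohr–Sommerfeld condition. -/
theorem mult_comm_iff (𝒯 : SymplecticTorus g V) {X Y : V} :
    𝒯.mult X Y = 𝒯.mult Y X ↔ ∃ n : ℤ, 𝒯.k * 𝒯.ω X Y = n := by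
  rw [← mul_inv_eq_one, ← eq_inv_of_mul_eq_one_left (𝒯.mult_mul_swap X Y), mult,
    ← Circle.exp_add, Circle.exp_eq_one]
  refine exists_congr fun n => ⟨fun h => ?_, fun h => by rw [h]; ring⟩
  have := Real.pi_pos.ne'
  have h2 : Real.pi * (2 * (𝒯.k * 𝒯.ω X Y - n)) = 0 := by linear_combination h
  have h3 := (mul_eq_zero.1 h2).resolve_left this
  linarith

/-- The sum over the classes modulo `K + Z` of the values of a function at representatives. -/
noncomputable def leafSum (𝒯 : SymplecticTorus g V) (K : Submodule ℝ V) (h : V → ℂ) : ℂ :=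
  ∑ᶠ C : V ⧸ (K.restrictScalars ℤ ⊔ 𝒯.Z), h (Quotient.out C)

/-- Invariance of a function under `K + Z`. -/
def LeafInvariant (𝒯 : SymplecticTorus g V) (K : Submodule ℝ V) (h : V → ℂ) : Prop :=
  ∀ X, ∀ Y ∈ K.restrictScalars ℤ ⊔ 𝒯.Z, h (X + Y) = h X

theorem LeafInvariant.eq_of_mk {𝒯 : SymplecticTorus g V} {K : Submodule ℝ V} {h : V → ℂ}
    (hh : 𝒯.LeafInvariant K h) {X Y : V}
    (e : (Submodule.Quotient.mk X : V ⧸ (K.restrictScalars ℤ ⊔ 𝒯.Z)) = Submodule.Quotient.mk Y) :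
    h X = h Y := by
  have := hh Y (X - Y) ((Submodule.Quotient.eq _).1 e)
  rwa [add_sub_cancel] at this

theorem mk_out {M : Type*} [AddCommGroup M] (N : Submodule ℤ M) (C : M ⧸ N) :
    (Submodule.Quotient.mk (Quotient.out C) : M ⧸ N) = C := Quotient.out_eq C

/-- Translation by `x` permutes the classes; invariance of `h` absorbs the discrepancy between the
shifted representative and the chosen representative of the shifted class. -/
theorem leafSum_shift {𝒯 : SymplecticTorus g V} {K : Submodule ℝ V} {h : V → ℂ}
    (hh : 𝒯.LeafInvariant K h) (x : V) : 𝒯.leafSum K (fun X => h (X - x)) = 𝒯.leafSum K h := by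
  refine Eq.trans (finsum_congr fun C => hh.eq_of_mk ?_) (finsum_comp_equiv (Equiv.subRight
    (Submodule.Quotient.mk x : V ⧸ (K.restrictScalars ℤ ⊔ 𝒯.Z)))
    (f := fun C => h (Quotient.out C)))
  rw [mk_out, Submodule.Quotient.mk_sub, mk_out]
  rfl

/-- A `finsum` with infinite support is `0` by convention, so additivity needs a finite set
containing both supports. -/
theorem leafSum_add {𝒯 : SymplecticTorus g V} {K : Submodule ℝ V} {h h' : V → ℂ}
    {S : Set (V ⧸ (K.restrictScalars ℤ ⊔ 𝒯.Z))} (hS : S.Finite)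
    (hh : ∀ X, h X ≠ 0 → Submodule.Quotient.mk X ∈ S)
    (hh' : ∀ X, h' X ≠ 0 → Submodule.Quotient.mk X ∈ S) :
    𝒯.leafSum K (fun X => h X + h' X) = 𝒯.leafSum K h + 𝒯.leafSum K h' := by
  refine finsum_add_distrib (hS.subset fun C hC => ?_) (hS.subset fun C hC => ?_)
  · rw [← mk_out _ C]; exact hh _ hC
  · rw [← mk_out _ C]; exact hh' _ hC

theorem leafSum_const_mul {𝒯 : SymplecticTorus g V} {K : Submodule ℝ V} (h : V → ℂ) (c : ℂ) :
    𝒯.leafSum K (fun X => c * h X) = c * 𝒯.leafSum K h := (mul_finsum _ _).symm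

theorem integral_unitCube_const (n : ℕ) {F : (Fin n → ℝ) → ℂ} {c : ℂ} (hF : ∀ t, F t = c) :
    ∫ t in Set.Icc (0 : Fin n → ℝ) 1, F t = c := by
  simp_rw [hF]
  rw [MeasureTheory.setIntegral_const]
  simp [MeasureTheory.measureReal_def, Real.volume_Icc_pi]

namespace Polarization

variable {𝒯 : SymplecticTorus g V}

/-! ### Half-densities -/

/-- A dependent family lies in a hyperplane `ker φ`. The transvection `v ↦ v + φ(v) u` with `φ(u) =
1` fixes the family and has determinant `2`, whence `ν f = √2 * ν f`. -/
theorem IsHalfDensity.eq_zero {P : 𝒯.Polarization} {ν : (Fin g → P.L) → ℂ}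
    (hν : P.IsHalfDensity ν) {f : Fin g → P.L} (hf : ¬ LinearIndependent ℝ f) : ν f = 0 := by
  have hfd := 𝒯.finiteDimensional
  have hlt : Submodule.span ℝ (Set.range f) < ⊤ := by
    rw [lt_top_iff_ne_top]
    intro h
    exact hf (linearIndependent_of_top_le_span_of_card_eq_finrank h.ge (by simp [P.finrank_L]))
  obtain ⟨φ, hφ, hle⟩ := Submodule.exists_le_ker_of_lt_top _ hlt
  obtain ⟨u, hu⟩ : ∃ u, φ u = 1 := by
    obtain ⟨v, hv⟩ : ∃ v, φ v ≠ 0 := by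
      by_contra! h
      exact hφ (LinearMap.ext h)
    exact ⟨(φ v)⁻¹ • v, by simp [hv]⟩
  have hdet : LinearMap.det (LinearMap.transvection φ u) = 2 := by
    rw [LinearMap.transvection.det, hu]; norm_num
  let a := LinearMap.equivOfDetNeZero (LinearMap.transvection φ u) (by rw [hdet]; norm_num)
  have ha : (a : P.L →ₗ[ℝ] P.L) = LinearMap.transvection φ u := by
    ext; rfl
  have h := hν a f
  have hf' : (fun i => a (f i)) = f := by
    funext i
    have h0 : φ (f i) = 0 := hle (Submodule.subset_span ⟨i, rfl⟩)
    have : a (f i) = LinearMap.transvection φ u (f i) := by rw [← ha]; rfl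
    rw [this, LinearMap.transvection.apply, h0, zero_smul, add_zero]
  rw [hf', ha, hdet] at h
  have h2 : (Real.sqrt |2| : ℂ) ≠ 1 := by
    norm_num
  by_contra h0
  exact h2 (mul_right_cancel₀ h0 (by rw [one_mul]; exact h.symm))

/-- The defining rule concerns automorphisms of `L` only. An independent `f` is the image of `b`
under an automorphism of determinant `b.det f`; for a dependent `f` both sides vanish. -/
theorem IsHalfDensity.apply_eq {P : 𝒯.Polarization} {ν : (Fin g → P.L) → ℂ}
    (hν : P.IsHalfDensity ν) (b : Module.Basis (Fin g) ℝ P.L) (f : Fin g → P.L) :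
    ν f = (Real.sqrt |b.det f| : ℂ) * ν b := by
  by_cases hf : LinearIndependent ℝ f
  · have hfd := 𝒯.finiteDimensional
    let b' : Module.Basis (Fin g) ℝ P.L := basisOfLinearIndependentOfCardEqFinrank' f hf
      (by simp [P.finrank_L])
    have hb' : ⇑b' = f := coe_basisOfLinearIndependentOfCardEqFinrank' f hf _
    have h := hν (b.equiv b' (Equiv.refl _)) b
    have e : (fun i => b.equiv b' (Equiv.refl _) (b i)) = f := by
      funext i
      simp [hb']
    have hd := b.det_comp (b.equiv b' (Equiv.refl _) : P.L →ₗ[ℝ] P.L) b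
    rw [show ((b.equiv b' (Equiv.refl _) : P.L →ₗ[ℝ] P.L) ∘ b : Fin g → P.L) = f from e,
      b.det_self, mul_one] at hd
    rw [e, ← hd] at h
    exact h
  · rw [hν.eq_zero hf, show b.det f = 0 from ?_]
    · simp
    · by_contra h0
      exact hf ((Module.Basis.is_basis_iff_det b).2 (isUnit_iff_ne_zero.2 h0)).1

/-! ### Flat sections -/

/-- The covariantly constant sections, without restriction on the support. -/
noncomputable def flatSections (P : 𝒯.Polarization) : Submodule ℂ P.Amplitude where
  carrier := {ψ |
    (∀ X, P.IsHalfDensity (ψ X)) ∧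
    (∀ W ∈ 𝒯.Z, ∀ X f, ψ (X + W) f = 𝒯.mult W X * ψ X f) ∧
    (∀ Y ∈ P.L, ∀ X f, ψ (X + Y) f = 𝒯.mult X Y * ψ X f)}
  zero_mem' := by
    refine ⟨fun _ _ _ => by simp, fun _ _ _ _ => by simp, fun _ _ X f => by simp⟩
  add_mem' := by
    rintro ψ φ ⟨h2, h3, h4⟩ ⟨h2', h3', h4'⟩
    refine ⟨fun X a f => ?_, fun W hW X f => ?_, fun Y hY X f => ?_⟩
    · simp [h2 X a f, h2' X a f, mul_add]
    · simp [h3 W hW X f, h3' W hW X f, mul_add]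
    · simp [h4 Y hY X f, h4' Y hY X f, mul_add]
  smul_mem' := by
    rintro c ψ ⟨h2, h3, h4⟩
    refine ⟨fun X a f => ?_, fun W hW X f => ?_, fun Y hY X f => ?_⟩
    · simp [h2 X a f, mul_left_comm]
    · simp [h3 W hW X f, mul_left_comm]
    · simp [h4 Y hY X f, mul_left_comm]

theorem eq_exp_of_hasDerivAt {u : ℝ → ℂ} {c : ℂ} (hu : ∀ t, HasDerivAt u (c * u t) t) (t : ℝ) :
    u t = Complex.exp (c * t) * u 0 := by
  have hd : ∀ s : ℝ, HasDerivAt (fun t : ℝ => Complex.exp (-(c * t)) * u t) 0 s := by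
    intro s
    have h1 : HasDerivAt (fun t : ℝ => -(c * (t : ℂ))) (-(c * (1 : ℝ))) s :=
      (((hasDerivAt_id s).ofReal_comp).const_mul c).neg
    refine (h1.cexp.mul (hu s)).congr_deriv ?_
    push_cast
    ring
  have h := is_const_of_deriv_eq_zero (fun s => (hd s).differentiableAt) (fun s => (hd s).deriv) t 0
  simp only [Complex.ofReal_zero, mul_zero, neg_zero, Complex.exp_zero, one_mul] at h
  rw [← h, ← mul_assoc, ← Complex.exp_add]
  simp

theorem coe_mult (X Y : V) :
    (𝒯.mult X Y : ℂ) = Complex.exp (2 * Real.pi * Complex.I * 𝒯.k * (𝒯.ω X Y / 2 : ℝ)) := by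
  rw [mult, Circle.coe_exp]
  congr 1
  push_cast
  ring

/-- The connection equation is imposed at `t = 0` from every base point. Since `ω(Y, Y) = 0`, its
coefficient is constant along the line `X + t Y`, so moving the base point gives `u' = c u` for all
`t`; the solution at `t = 1` is parallel transport by `Y`. -/
theorem leafSections_le_flatSections (P : 𝒯.Polarization) (Λ : P.Leaf) :
    P.leafSections Λ ≤ P.flatSections := by
  rintro ψ ⟨-, h2, h3, h4⟩
  refine ⟨h2, h3, fun Y hY X f => ?_⟩
  have hu : ∀ t : ℝ, HasDerivAt (fun t : ℝ => ψ (X + t • Y) f)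
      ((2 * Real.pi * Complex.I * 𝒯.k * (𝒯.ω X Y / 2 : ℝ)) * ψ (X + t • Y) f) t := by
    intro t
    have h := h4 Y hY (X + t • Y) f
    rw [map_add, LinearMap.add_apply, map_smul, LinearMap.smul_apply, 𝒯.isAlt, smul_zero,
      add_zero] at h
    have e : (fun s : ℝ => ψ (X + t • Y + (s - t) • Y) f) = fun s : ℝ => ψ (X + s • Y) f := by
      funext s
      congr 1
      rw [sub_smul]; abel
    have h' := HasDerivAt.comp_sub_const t t (f := fun s : ℝ => ψ (X + t • Y + s • Y) f)
      (by rw [sub_self]; exact h)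
    rwa [e] at h'
  have := eq_exp_of_hasDerivAt hu 1
  simpa [coe_mult] using this

theorem quantization_le_flatSections (P : 𝒯.Polarization) : P.quantization ≤ P.flatSections :=
  iSup₂_le fun Λ _ => P.leafSections_le_flatSections Λ

/-- The points over the Bohr–Sommerfeld leaves. -/
def bsPoints (P : 𝒯.Polarization) : Set V :=
  {X | ∀ W ∈ 𝒯.Z, W ∈ P.L → ∃ n : ℤ, 𝒯.k * 𝒯.ω W X = n}

/-- A vector `W` of `L ∩ Z` acts both by parallel transport and by the lattice. The two factors must
agree where the section is nonzero: the holonomy is trivial. -/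
theorem mem_bsPoints_of_ne_zero {P : 𝒯.Polarization} {ψ : P.Amplitude} (hψ : ψ ∈ P.flatSections)
    {X : V} {f : Fin g → P.L} (h : ψ X f ≠ 0) : X ∈ P.bsPoints := by
  intro W hW hL
  have h1 := hψ.2.1 W hW X f
  rw [hψ.2.2 W hL X f] at h1
  exact 𝒯.mult_comm_iff.1 (Circle.ext (mul_right_cancel₀ h h1.symm))

/-- Both sections acquire the same unimodular factor, under `Z` as well as under `K`, which lies in
both Lagrangians; conjugating one of them cancels it. -/
theorem leafInvariant_pairing {P₂ P₁ : 𝒯.Polarization} {K : Submodule ℝ V} (h₁ : K ≤ P₁.L)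
    (h₂ : K ≤ P₂.L) {ψ₂ : P₂.Amplitude} {ψ₁ : P₁.Amplitude} (hψ₂ : ψ₂ ∈ P₂.flatSections)
    (hψ₁ : ψ₁ ∈ P₁.flatSections) (f₂ : Fin g → P₂.L) (f₁ : Fin g → P₁.L) :
    𝒯.LeafInvariant K (fun X => (starRingEnd ℂ) (ψ₂ X f₂) * ψ₁ X f₁) := by
  have key : ∀ (z : Circle) (a b : ℂ), (starRingEnd ℂ) (z * a) * (z * b) =
      (starRingEnd ℂ) a * b := by
    intro z a b
    have : (starRingEnd ℂ) (z : ℂ) * z = 1 := by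
      rw [← Complex.normSq_eq_conj_mul_self, Circle.normSq_coe, Complex.ofReal_one]
    rw [map_mul]
    linear_combination (starRingEnd ℂ) a * b * this
  intro X Y hY
  obtain ⟨Y, hYK, W, hW, rfl⟩ := Submodule.mem_sup.1 hY
  have hYK' : Y ∈ K := hYK
  simp only
  rw [← add_assoc, hψ₂.2.1 W hW, hψ₁.2.1 W hW, key, hψ₂.2.2 Y (h₂ hYK'), hψ₁.2.2 Y (h₁ hYK'), key]

/-! ### Inner product and pairing as sums over classes -/

theorem innerProd_eq_leafSum {P : 𝒯.Polarization} {ψ φ : P.Amplitude} (hψ : ψ ∈ P.flatSections)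
    (hφ : φ ∈ P.flatSections) : P.innerProd ψ φ =
      𝒯.leafSum P.L (fun X => (starRingEnd ℂ) (ψ X P.latticeBasis) * φ X P.latticeBasis) := by
  refine finsum_congr fun Λ => integral_unitCube_const g fun t => ?_
  refine leafInvariant_pairing le_rfl le_rfl hψ hφ _ _ _ _ (Submodule.mem_sup_left ?_)
  exact Submodule.sum_mem P.L fun i _ => P.L.smul_mem _ (P.latticeBasis i).2

theorem bksPairing_eq_leafSum {P₂ P₁ : 𝒯.Polarization} {ψ₂ : P₂.Amplitude} {ψ₁ : P₁.Amplitude}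
    (hψ₂ : ψ₂ ∈ P₂.flatSections) (hψ₁ : ψ₁ ∈ P₁.flatSections) : bksPairing P₂ P₁ ψ₂ ψ₁ =
      𝒯.leafSum (P₁.L ⊓ P₂.L) (fun X => (starRingEnd ℂ) (ψ₂ X (pairingFrame P₂ P₁).U₂) *
        ψ₁ X (pairingFrame P₂ P₁).U₁) := by
  refine finsum_congr fun Λ => integral_unitCube_const _ fun t => ?_
  refine leafInvariant_pairing inf_le_left inf_le_right hψ₂ hψ₁ _ _ _ _
    (Submodule.mem_sup_left ?_)
  exact Submodule.sum_mem (P₁.L ⊓ P₂.L) fun i _ => Submodule.smul_mem _ _ (Subtype.mem _)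

/-- The phase of `x` and the multiplier do not depend on the polarization, so they cancel in the
product. What remains is a shift of the argument by `x.vec`. -/
theorem leafSum_translation {P₂ P₁ : 𝒯.Polarization} {K : Submodule ℝ V} (h₁ : K ≤ P₁.L)
    (h₂ : K ≤ P₂.L) {ψ₂ : P₂.Amplitude} {ψ₁ : P₁.Amplitude} (hψ₂ : ψ₂ ∈ P₂.flatSections)
    (hψ₁ : ψ₁ ∈ P₁.flatSections) (f₂ : Fin g → P₂.L) (f₁ : Fin g → P₁.L) (x : 𝒯.PreHeisenberg) :
    𝒯.leafSum K (fun X => (starRingEnd ℂ) (P₂.translation x ψ₂ X f₂) *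
      P₁.translation x ψ₁ X f₁) =
    𝒯.leafSum K (fun X => (starRingEnd ℂ) (ψ₂ X f₂) * ψ₁ X f₁) := by
  rw [← leafSum_shift (leafInvariant_pairing h₁ h₂ hψ₂ hψ₁ f₂ f₁) x.vec]
  congr 1
  funext X
  simp only [translation_apply]
  have key : ∀ (z : Circle), (starRingEnd ℂ) (z : ℂ) * z = 1 := fun z => by
    rw [← Complex.normSq_eq_conj_mul_self, Circle.normSq_coe, Complex.ofReal_one]
  rw [map_mul, map_mul]
  -- With `p`, `m` the two unimodular factors: `|p|² |m|² - 1 = |m|² (|p|² - 1) + (|m|² - 1)`.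
  linear_combination (starRingEnd ℂ) (ψ₂ (X - x.vec) f₂) * ψ₁ (X - x.vec) f₁ *
    ((starRingEnd ℂ) (𝒯.mult x.vec (X - x.vec) : ℂ) * 𝒯.mult x.vec (X - x.vec) * key x.phase +
      key (𝒯.mult x.vec (X - x.vec)))

/-! ### Invariance under the Heisenberg group -/

theorem innerProd_heisenbergRep (P : 𝒯.Polarization) (x : 𝒯.Heisenberg) (ψ φ : P.quantization) :
    P.innerProd (P.heisenbergRep x ψ) (P.heisenbergRep x φ) = P.innerProd ψ φ := by
  have hle := P.quantization_le_flatSections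
  rw [innerProd_eq_leafSum (hle (Subtype.mem _)) (hle (Subtype.mem _)),
    innerProd_eq_leafSum (hle ψ.2) (hle φ.2)]
  induction x using QuotientGroup.induction_on with
  | H x => exact leafSum_translation le_rfl le_rfl (hle ψ.2) (hle φ.2) _ _ x

theorem bksPairing_heisenbergRep (P₂ P₁ : 𝒯.Polarization) (x : 𝒯.Heisenberg)
    (ψ₂ : P₂.quantization) (ψ₁ : P₁.quantization) :
    bksPairing P₂ P₁ (P₂.heisenbergRep x ψ₂) (P₁.heisenbergRep x ψ₁) =
      bksPairing P₂ P₁ ψ₂ ψ₁ := by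
  have hle₁ := P₁.quantization_le_flatSections
  have hle₂ := P₂.quantization_le_flatSections
  rw [bksPairing_eq_leafSum (hle₂ (Subtype.mem _)) (hle₁ (Subtype.mem _)),
    bksPairing_eq_leafSum (hle₂ ψ₂.2) (hle₁ ψ₁.2)]
  induction x using QuotientGroup.induction_on with
  | H x => exact leafSum_translation inf_le_left inf_le_right (hle₂ ψ₂.2) (hle₁ ψ₁.2) _ _ x

theorem heisenbergRep_circleInclusion (P : 𝒯.Polarization) (z : Circle) (ψ : P.quantization) :
    P.heisenbergRep (𝒯.circleInclusion z) ψ = (z : ℂ) • ψ := by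
  refine Subtype.ext ?_
  funext X f
  change P.translation ⟨z, 0⟩ ψ X f = z * (ψ : P.Amplitude) X f
  simp [translation_apply, mult]

end Polarization

end SymplecticTorus

namespace SymplecticTorus

variable {g : ℕ} {V : Type*} [AddCommGroup V] [Module ℝ V]

/-! ### Existence of adapted bases -/

/-- Nondegeneracy produces a real vector `T` with the prescribed pairings on a basis of `Z`. It
pairs integrally with the whole lattice, so self-duality places it in `Z`. -/
theorem exists_of_int_functional (𝒯 : SymplecticTorus g V) (φ : 𝒯.Z →ₗ[ℤ] ℤ) :
    ∃ T : 𝒯.Z, ∀ z : 𝒯.Z, 𝒯.ω z T = φ z := by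
  have hfd := 𝒯.finiteDimensional
  obtain ⟨b, hb⟩ := 𝒯.isLattice
  have hbZ : ∀ i, b i ∈ 𝒯.Z := fun i => hb ▸ Submodule.subset_span ⟨i, rfl⟩
  obtain ⟨T, hT⟩ := exists_pairing_eq 𝒯.ω 𝒯.nondegenerate b b.linearIndependent
    (fun i => φ ⟨b i, hbZ i⟩)
  have key : ∀ z (hz : z ∈ 𝒯.Z), 𝒯.ω z T = φ ⟨z, hz⟩ := by
    intro z hz
    have hz' : z ∈ Submodule.span ℤ (Set.range b) := hb ▸ hz
    obtain ⟨c, rfl⟩ := (Submodule.mem_span_range_iff_exists_fun ℤ).1 hz'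
    have e : (⟨∑ i, c i • b i, hz⟩ : 𝒯.Z) = ∑ i, c i • (⟨b i, hbZ i⟩ : 𝒯.Z) :=
      Subtype.ext (by simp)
    rw [e, map_sum]
    simp only [map_sum, map_smul, LinearMap.sum_apply]
    simp [hT, ← Int.cast_smul_eq_zsmul ℝ]
  refine ⟨⟨T, (𝒯.selfDual T).2 fun W hW => ⟨- φ ⟨W, hW⟩, ?_⟩⟩, fun z => key z z.2⟩
  rw [𝒯.skew, key W hW]
  push_cast
  rfl

theorem eq_sum_of_dual (𝒯 : SymplecticTorus g V) (W Wp : Fin g → V)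
    (h1 : ∀ i j, 𝒯.ω (W i) (Wp j) = if i = j then 1 else 0) (h2 : ∀ i j, 𝒯.ω (W i) (W j) = 0)
    (h3 : ∀ i j, 𝒯.ω (Wp i) (Wp j) = 0) (X : V) :
    X = ∑ i, 𝒯.ω X (Wp i) • W i + ∑ i, 𝒯.ω (W i) X • Wp i := by
  have hfd := 𝒯.finiteDimensional
  have li : LinearIndependent ℝ (Sum.elim W Wp) := by
    rw [Fintype.linearIndependent_iff]
    intro c hc
    simp only [Fintype.sum_sum_type, Sum.elim_inl, Sum.elim_inr] at hc
    rintro (j | j)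
    · have := congrArg (fun Y => 𝒯.ω Y (Wp j)) hc
      simpa [h1, h3] using this
    · have := congrArg (fun Y => 𝒯.ω (W j) Y) hc
      simpa [h1, h2] using this
  have hspan : Submodule.span ℝ (Set.range (Sum.elim W Wp)) = ⊤ :=
    li.span_eq_top_of_card_eq_finrank' (by simp [𝒯.finrank_eq]; ring)
  have hX : X ∈ Submodule.span ℝ (Set.range (Sum.elim W Wp)) := hspan ▸ Submodule.mem_top
  obtain ⟨c, rfl⟩ := (Submodule.mem_span_range_iff_exists_fun ℝ).1 hX
  simp [h1, h2, h3]

namespace Polarization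

variable {𝒯 : SymplecticTorus g V}

theorem span_latticeBasis (P : 𝒯.Polarization) :
    Submodule.span ℤ (Set.range fun i => (P.latticeBasis i : V)) =
      P.L.restrictScalars ℤ ⊓ 𝒯.Z := P.exists_latticeBasis.choose_spec

/-- Since `L` is a real subspace, `Z / (L ∩ Z)` is torsion free; being finitely generated it is
free, so the projection has a section `s`, and `1 - s ∘ mkQ` retracts `Z` onto `L ∩ Z`. -/
theorem exists_retraction (P : 𝒯.Polarization) :
    ∃ r : 𝒯.Z →ₗ[ℤ] 𝒯.Z, (∀ z : 𝒯.Z, (r z : V) ∈ P.L) ∧ ∀ z : 𝒯.Z, (z : V) ∈ P.L → r z = z := by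
  obtain ⟨b, hb⟩ := 𝒯.isLattice
  have hfin : Module.Finite ℤ 𝒯.Z := by
    rw [hb]; exact Module.Finite.of_basis (b.restrictScalars ℤ)
  let N : Submodule ℤ 𝒯.Z := (P.L.restrictScalars ℤ).comap 𝒯.Z.subtype
  have hN : ∀ z : 𝒯.Z, z ∈ N ↔ (z : V) ∈ P.L := fun z => Iff.rfl
  have htf : Module.IsTorsionFree ℤ (𝒯.Z ⧸ N) := by
    rw [Module.isTorsionFree_iff_smul_eq_zero]
    intro n x hx
    obtain ⟨z, rfl⟩ := Submodule.Quotient.mk_surjective N x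
    rw [← Submodule.Quotient.mk_smul, Submodule.Quotient.mk_eq_zero] at hx
    rw [Submodule.Quotient.mk_eq_zero]
    refine or_iff_not_imp_left.2 fun hn => ?_
    have hx' : n • (z : V) ∈ P.L := hx
    rw [← Int.cast_smul_eq_zsmul ℝ] at hx'
    exact (P.L.smul_mem_iff (by exact_mod_cast hn)).1 hx'
  have hfree : Module.Free ℤ (𝒯.Z ⧸ N) := Module.free_of_finite_type_torsion_free'
  obtain ⟨s, hs⟩ := Module.projective_lifting_property N.mkQ LinearMap.id N.mkQ_surjective
  refine ⟨LinearMap.id - s.comp N.mkQ, fun z => ?_, fun z hz => ?_⟩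
  · refine (hN _).1 ((Submodule.Quotient.mk_eq_zero N).1 ?_)
    have := LinearMap.congr_fun hs (N.mkQ z)
    simp only [LinearMap.comp_apply, LinearMap.id_apply] at this
    change N.mkQ (z - s (N.mkQ z)) = 0
    rw [map_sub, this, sub_self]
  · have : N.mkQ z = 0 := (Submodule.Quotient.mk_eq_zero N).2 ((hN z).2 hz)
    simp [this]

/-- The coordinates along the basis of `L ∩ Z`, composed with the retraction, are integral
functionals on `Z`; `T j` represents the `j`-th one. -/
theorem exists_dual_lattice_family (P : 𝒯.Polarization) :
    ∃ T : Fin g → 𝒯.Z, ∀ i j, 𝒯.ω (P.latticeBasis i) (T j) = if i = j then 1 else 0 := by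
  obtain ⟨r, hr, hr'⟩ := P.exists_retraction
  have hZ : ∀ i, (P.latticeBasis i : V) ∈ 𝒯.Z := fun i =>
    (P.span_latticeBasis.le (Submodule.subset_span ⟨i, rfl⟩)).2
  let c (j : Fin g) : 𝒯.Z →ₗ[ℤ] ℝ := ((P.latticeBasis.coord j).restrictScalars ℤ).comp
    ((𝒯.Z.subtype.comp r).codRestrict (P.L.restrictScalars ℤ) hr)
  have hc : ∀ j z, c j z = P.latticeBasis.repr ⟨r z, hr z⟩ j := fun j z => rfl
  have hint : ∀ j z, ∃ n : ℤ, c j z = n := by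
    intro j z
    have h : (r z : V) ∈ Submodule.span ℤ (Set.range fun i => (P.latticeBasis i : V)) := by
      rw [P.span_latticeBasis]; exact ⟨hr z, (r z).2⟩
    obtain ⟨a, ha⟩ := (Submodule.mem_span_range_iff_exists_fun ℤ).1 h
    refine ⟨a j, ?_⟩
    have e : (⟨r z, hr z⟩ : P.L) = ∑ i, (a i : ℝ) • P.latticeBasis i :=
      Subtype.ext (by simp [← ha, Int.cast_smul_eq_zsmul])
    rw [hc, e]
    simp [Finsupp.single_apply]
  choose n hn using hint
  let φ (j : Fin g) : 𝒯.Z →ₗ[ℤ] ℤ :=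
    { toFun := n j
      map_add' := fun x y => by
        have := hn j (x + y)
        rw [map_add, hn, hn] at this
        exact_mod_cast this.symm
      map_smul' := fun m x => by
        have := hn j (m • x)
        rw [map_smul, hn, zsmul_eq_mul] at this
        exact_mod_cast this.symm }
  choose T hT using fun j => 𝒯.exists_of_int_functional (φ j)
  refine ⟨T, fun i j => ?_⟩
  have h1 := hT j ⟨_, hZ i⟩
  have h2 := hn j ⟨_, hZ i⟩
  have e : (⟨r ⟨_, hZ i⟩, hr _⟩ : P.L) = P.latticeBasis i :=
    Subtype.ext (congrArg (fun z : 𝒯.Z => (z : V)) (hr' ⟨_, hZ i⟩ (P.latticeBasis i).2))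
  rw [hc, e, Module.Basis.repr_self, Finsupp.single_apply] at h2
  exact h1.trans h2.symm

theorem adaptedBasis_nonempty (P : 𝒯.Polarization) : Nonempty P.AdaptedBasis := by
  obtain ⟨T, hT⟩ := P.exists_dual_lattice_family
  have hZ : ∀ i, (P.latticeBasis i : V) ∈ 𝒯.Z := fun i =>
    (P.span_latticeBasis.le (Submodule.subset_span ⟨i, rfl⟩)).2
  have hint : ∀ i j, ∃ n : ℤ, 𝒯.ω (T i) (T j) = n := fun i j =>
    (𝒯.selfDual _).1 (T i).2 _ (T j).2
  choose n hn using hint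
  let W : Fin g → 𝒯.Z := fun i => ⟨P.latticeBasis i, hZ i⟩
  -- Adding `∑ i, c i j • W i` to `T j` turns `ω(T i, T j) = n i j` into `n i j - c i j + c j i`.
  -- The strictly upper triangular part of the skew matrix `n` cancels it without dividing by `2`,
  -- so the correction stays in `Z`.
  let c : Fin g → Fin g → ℤ := fun i j => if i < j then n i j else 0
  let Wp : Fin g → 𝒯.Z := fun j => T j + ∑ i, c i j • W i
  have hWW : ∀ i j, 𝒯.ω (W i) (W j) = 0 := fun i j =>
    P.isotropic _ (P.latticeBasis i).2 _ (P.latticeBasis j).2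
  have hWT : ∀ i j, 𝒯.ω (W i) (T j) = if i = j then 1 else 0 := hT
  have hTW : ∀ i j, 𝒯.ω (T i) (W j) = if j = i then -1 else 0 := fun i j => by
    rw [𝒯.skew, hWT]; split_ifs <;> simp
  have hWp : ∀ j, (Wp j : V) = T j + ∑ i, (c i j : ℝ) • (W i : V) := fun j => by
    simp [Wp, Int.cast_smul_eq_zsmul]
  have h1 : ∀ i j, 𝒯.ω (W i) (Wp j) = if i = j then 1 else 0 := fun i j => by
    simp [hWp, hWT, hWW]
  have h3 : ∀ i j, 𝒯.ω (Wp i) (Wp j) = 0 := fun i j => by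
    simp only [hWp, map_add, LinearMap.add_apply, map_sum, LinearMap.sum_apply, map_smul,
      LinearMap.smul_apply, hWT, hTW, hWW, hn, smul_eq_mul]
    have hs : (n i j : ℝ) = - n j i := by rw [← hn, ← hn]; exact 𝒯.skew _ _
    have hd : (n i i : ℝ) = 0 := by rw [← hn]; exact 𝒯.isAlt _
    simp only [c, mul_ite, mul_one, mul_zero, mul_neg, Finset.sum_ite_eq', Finset.mem_univ,
      if_true, Finset.sum_const_zero, add_zero]
    rcases lt_trichotomy i j with h | h | h
    · simp [h, h.not_gt]
    · subst h; simp [hd]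
    · simp [h, h.not_gt, hs]
  refine ⟨{ W := W, Wp := Wp, span_Z := le_antisymm ?_ fun X hX => ?_, span_L := ?_,
            pair_W_Wp := h1, pair_W_W := hWW, pair_Wp_Wp := h3 }⟩
  · rw [Submodule.span_le]
    rintro _ (⟨i, rfl⟩ | ⟨i, rfl⟩)
    exacts [(W i).2, (Wp i).2]
  -- The real coordinates of a lattice vector are its pairings with lattice vectors, hence integers.
  · rw [𝒯.eq_sum_of_dual _ _ h1 hWW h3 X]
    refine Submodule.add_mem _ (Submodule.sum_mem _ fun i _ => ?_)
      (Submodule.sum_mem _ fun i _ => ?_)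
    · obtain ⟨m, hm⟩ := (𝒯.selfDual X).1 hX _ (Wp i).2
      rw [hm, Int.cast_smul_eq_zsmul]
      exact Submodule.smul_mem _ _ (Submodule.subset_span (Or.inl ⟨i, rfl⟩))
    · obtain ⟨m, hm⟩ := (𝒯.selfDual _).1 (W i).2 X hX
      rw [hm, Int.cast_smul_eq_zsmul]
      exact Submodule.smul_mem _ _ (Submodule.subset_span (Or.inr ⟨i, rfl⟩))
  · have := congrArg (Submodule.map P.L.subtype) P.latticeBasis.span_eq
    rw [Submodule.map_span, ← Set.range_comp, Submodule.map_subtype_top] at this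
    exact this

namespace AdaptedBasis

variable {P : 𝒯.Polarization}

/-! ### Coordinates and half-density of an adapted basis -/

theorem pair_Wp_W (B : P.AdaptedBasis) (i j : Fin g) :
    𝒯.ω (B.Wp i) (B.W j) = if j = i then -1 else 0 := by
  rw [𝒯.skew, B.pair_W_Wp]; split_ifs <;> simp

theorem eq_sum (B : P.AdaptedBasis) (X : V) :
    X = ∑ i, 𝒯.ω X (B.Wp i) • (B.W i : V) + ∑ i, 𝒯.ω (B.W i) X • (B.Wp i : V) :=
  𝒯.eq_sum_of_dual _ _ B.pair_W_Wp B.pair_W_W B.pair_Wp_Wp X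

theorem W_mem (B : P.AdaptedBasis) (i : Fin g) : (B.W i : V) ∈ P.L :=
  B.span_L.le (Submodule.subset_span ⟨i, rfl⟩)

theorem linearIndependent_W (B : P.AdaptedBasis) :
    LinearIndependent ℝ (fun i => (⟨B.W i, B.W_mem i⟩ : P.L)) := by
  rw [Fintype.linearIndependent_iff]
  intro c hc j
  have := congrArg (fun Y : P.L => 𝒯.ω Y (B.Wp j)) hc
  simpa [B.pair_W_Wp] using this

/-- The vectors `W₁, …, W_g` as a basis of `L`. -/
noncomputable def basisL (B : P.AdaptedBasis) : Module.Basis (Fin g) ℝ P.L :=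
  haveI := 𝒯.finiteDimensional
  basisOfLinearIndependentOfCardEqFinrank' _ B.linearIndependent_W (by simp [P.finrank_L])

theorem coe_basisL (B : P.AdaptedBasis) (i : Fin g) : (B.basisL i : V) = B.W i := by
  simp [basisL]

theorem omega_W_of_mem (B : P.AdaptedBasis) {Y : V} (hY : Y ∈ P.L) (i : Fin g) :
    𝒯.ω (B.W i) Y = 0 := P.isotropic _ (B.W_mem i) _ hY

theorem basisL_repr (B : P.AdaptedBasis) (Y : P.L) (i : Fin g) :
    B.basisL.repr Y i = 𝒯.ω Y (B.Wp i) := by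
  have e : Y = ∑ i, 𝒯.ω Y (B.Wp i) • B.basisL i := by
    refine Subtype.ext ?_
    conv_lhs => rw [B.eq_sum Y]
    simp [B.omega_W_of_mem Y.2, coe_basisL]
  conv_lhs => rw [e]
  simp [Finsupp.single_apply]

theorem delta_eq (B : P.AdaptedBasis) (f : Fin g → P.L) :
    B.delta f = Real.sqrt |B.basisL.det f| := by
  rw [delta, Module.Basis.det_apply]
  congr 3
  ext i j
  rw [Module.Basis.toMatrix_apply, basisL_repr, Matrix.of_apply]

theorem isHalfDensity_delta (B : P.AdaptedBasis) : P.IsHalfDensity (fun f => (B.delta f : ℂ)) := by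
  intro a f
  simp only [delta_eq]
  have := B.basisL.det_comp (a : P.L →ₗ[ℝ] P.L) f
  rw [show (fun i => a (f i)) = (a : P.L →ₗ[ℝ] P.L) ∘ f from rfl, this, abs_mul,
    Real.sqrt_mul (abs_nonneg _)]
  push_cast
  rfl

theorem delta_basisL (B : P.AdaptedBasis) : B.delta B.basisL = 1 := by
  rw [delta_eq, Module.Basis.det_self]; simp

theorem halfDensity_eq (B : P.AdaptedBasis) {ν : (Fin g → P.L) → ℂ} (hν : P.IsHalfDensity ν)
    (f : Fin g → P.L) : ν f = B.delta f * ν B.basisL := by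
  rw [delta_eq]; exact hν.apply_eq _ _

/-- The transition matrices between the two bases are integral and mutually inverse, so the
determinant is `±1`. Thus `δ` is normalized also on the frame used in the definition of the inner
product. -/
theorem delta_latticeBasis (B : P.AdaptedBasis) : B.delta P.latticeBasis = 1 := by
  have hZ : ∀ i, (P.latticeBasis i : V) ∈ 𝒯.Z := fun i =>
    (P.span_latticeBasis.le (Submodule.subset_span ⟨i, rfl⟩)).2
  have h1 : ∀ i j, ∃ n : ℤ, B.basisL.toMatrix P.latticeBasis i j = n := by
    intro i j
    rw [Module.Basis.toMatrix_apply, basisL_repr]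
    exact (𝒯.selfDual _).1 (hZ j) _ (B.Wp i).2
  have h2 : ∀ i j, ∃ n : ℤ, P.latticeBasis.toMatrix B.basisL i j = n := by
    intro i j
    have h : (B.W j : V) ∈ Submodule.span ℤ (Set.range fun i => (P.latticeBasis i : V)) := by
      rw [P.span_latticeBasis]; exact ⟨B.W_mem j, (B.W j).2⟩
    obtain ⟨a, ha⟩ := (Submodule.mem_span_range_iff_exists_fun ℤ).1 h
    refine ⟨a i, ?_⟩
    have e : B.basisL j = ∑ i, (a i : ℝ) • P.latticeBasis i :=
      Subtype.ext (by simp [coe_basisL, ← ha, Int.cast_smul_eq_zsmul])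
    rw [Module.Basis.toMatrix_apply, e]
    simp [Finsupp.single_apply]
  choose n hn using h1
  choose m hm using h2
  have hn' : B.basisL.toMatrix P.latticeBasis = (Matrix.of n).map (Int.castRingHom ℝ) := by
    ext i j; simp [hn]
  have hm' : P.latticeBasis.toMatrix B.basisL = (Matrix.of m).map (Int.castRingHom ℝ) := by
    ext i j; simp [hm]
  have hp := B.basisL.toMatrix_mul_toMatrix_flip P.latticeBasis
  have hd := congrArg Matrix.det hp
  rw [Matrix.det_mul, hn', hm', Matrix.det_one, ← RingHom.mapMatrix_apply, ← RingHom.mapMatrix_apply,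
    ← RingHom.map_det, ← RingHom.map_det, ← map_mul] at hd
  have hu : (Matrix.of n).det * (Matrix.of m).det = 1 := by
    simpa only [eq_intCast, Int.cast_eq_one] using hd
  rw [delta_eq, Module.Basis.det_apply, hn', ← RingHom.mapMatrix_apply, ← RingHom.map_det]
  rcases Int.isUnit_iff.1 (IsUnit.of_mul_eq_one _ hu) with h | h <;> simp [h]

end AdaptedBasis

end Polarization

end SymplecticTorus

namespace SymplecticTorus

variable {g : ℕ} {V : Type*} [AddCommGroup V] [Module ℝ V]

namespace Polarization

variable {𝒯 : SymplecticTorus g V}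

/-- Writing `X = X' + Y + W` with `Y ∈ L` and `W ∈ Z`, the factor depends on the points only and not
on the section. Identities between flat sections can thus be checked at one point of each leaf. -/
theorem exists_common_factor (P : 𝒯.Polarization) {X X' : V} (h : P.leafOf X = P.leafOf X') :
    ∃ z : ℂ, ∀ ψ ∈ P.flatSections, ∀ f, ψ X f = z * ψ X' f := by
  have h' : X - X' ∈ P.L.restrictScalars ℤ ⊔ 𝒯.Z := (Submodule.Quotient.eq _).1 h
  obtain ⟨Y, hY, W, hW, e⟩ := Submodule.mem_sup.1 h'
  have hY' : Y ∈ P.L := hY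
  have e' : X = X' + Y + W := by rw [add_assoc, e]; abel
  refine ⟨𝒯.mult W (X' + Y) * 𝒯.mult X' Y, fun ψ hψ f => ?_⟩
  rw [e', hψ.2.1 W hW, hψ.2.2 Y hY', mul_assoc]

namespace AdaptedBasis

variable {P : 𝒯.Polarization} (B : P.AdaptedBasis)

/-! ### The potential -/

theorem omega_eq_sum (X Y : V) : 𝒯.ω X Y =
    ∑ i, 𝒯.ω X (B.Wp i) * 𝒯.ω (B.W i) Y - ∑ i, 𝒯.ω Y (B.Wp i) * 𝒯.ω (B.W i) X := by
  conv_lhs => rw [B.eq_sum X]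
  simp only [map_add, LinearMap.add_apply, map_sum, LinearMap.sum_apply, map_smul,
    LinearMap.smul_apply, smul_eq_mul, 𝒯.skew _ Y]
  rw [sub_eq_add_neg, ← Finset.sum_neg_distrib]
  congr 1
  exact Finset.sum_congr rfl fun i _ => by ring

/-- Polarization of the quadratic form `K`, with the cross term split asymmetrically: the last sum
vanishes when `Y` lies in the span of the `Wp i`, and `k` times it is an integer when `Y ∈ Z` and
`X` lies over a Bohr–Sommerfeld leaf. -/
theorem potential_add (X Y : V) : B.potential (X + Y) = B.potential X + B.potential Y +
    𝒯.ω X Y / 2 + ∑ i, 𝒯.ω Y (B.Wp i) * 𝒯.ω (B.W i) X := by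
  rw [B.omega_eq_sum X Y]
  simp only [potential, map_add, LinearMap.add_apply, add_mul, mul_add, Finset.sum_add_distrib]
  ring

theorem potential_add_of_mem (X : V) {Y : V} (hY : Y ∈ P.L) :
    B.potential (X + Y) = B.potential X - 𝒯.ω X Y / 2 := by
  have h : ∀ i, 𝒯.ω (B.W i) Y = 0 := B.omega_W_of_mem hY
  have h1 := B.omega_eq_sum X Y
  have h2 : B.potential Y = 0 := by simp [potential, h]
  simp only [h, mul_zero, Finset.sum_const_zero] at h1
  rw [B.potential_add, h2]
  linarith

/-- The phase `e ^ (- 2 π i k K(X))`. -/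
noncomputable def osc (X : V) : Circle := Circle.exp (-(2 * Real.pi * 𝒯.k * B.potential X))

theorem osc_add_of_mem (X : V) {Y : V} (hY : Y ∈ P.L) :
    B.osc (X + Y) = 𝒯.mult X Y * B.osc X := by
  rw [osc, osc, mult, ← Circle.exp_add, B.potential_add_of_mem X hY]
  congr 1
  ring

theorem osc_add_lattice {X W : V} (hX : ∀ i, ∃ n : ℤ, 𝒯.k * 𝒯.ω (B.W i) X = n)
    (hW : W ∈ 𝒯.Z) : B.osc (X + W) = 𝒯.mult W X * B.osc X := by
  have h1 : ∀ i, ∃ n : ℤ, 𝒯.ω W (B.Wp i) = n := fun i => (𝒯.selfDual _).1 hW _ (B.Wp i).2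
  have h2 : ∀ i, ∃ n : ℤ, 𝒯.ω (B.W i) W = n := fun i => (𝒯.selfDual _).1 (B.W i).2 _ hW
  choose a ha using h1
  choose b hb using h2
  choose c hc using hX
  obtain ⟨m, hm⟩ := 𝒯.k_even
  have hm' : (𝒯.k : ℝ) = m + m := by exact_mod_cast hm
  rw [osc, osc, mult, ← Circle.exp_add, Circle.exp_eq_exp]
  -- The two exponents differ by `-2 π k` times `K(W)` plus the cross sum. Evenness `k = 2 m` is
  -- what makes `k K(W) = m ∑ a b` an integer.
  refine ⟨-(m * ∑ i, a i * b i + ∑ i, a i * c i), ?_⟩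
  have e1 : ∑ i, 𝒯.ω W (B.Wp i) * 𝒯.ω (B.W i) X * 𝒯.k = ∑ i, (a i : ℝ) * c i :=
    Finset.sum_congr rfl fun i _ => by rw [ha, ← hc]; ring
  have e2 : B.potential W * 𝒯.k = m * ∑ i, (a i : ℝ) * b i := by
    simp only [potential, ha, hb, hm']
    ring
  rw [B.potential_add, 𝒯.skew X W]
  push_cast
  rw [← e2, ← e1, ← Finset.sum_mul]
  ring

/-! ### Supports -/

/-- The points over the leaf that carries the section with index `q`. -/
def support (q : Fin g → ZMod 𝒯.k) : Set V :=
  {X | ∀ i, ∃ n : ℤ, 𝒯.k * 𝒯.ω (B.W i) X = n ∧ (n : ZMod 𝒯.k) = q i}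

/-- `support` uses classes in `ZMod 𝒯.k`, so that shifting `q` involves no carry; `standardSection`
uses the representatives `(q i).val`. -/
theorem mem_support_iff {q : Fin g → ZMod 𝒯.k} {X : V} : X ∈ B.support q ↔
    ∀ i, ∃ l : ℤ, 𝒯.k * 𝒯.ω (B.W i) X = ((q i).val : ℝ) + 𝒯.k * l := by
  have : NeZero 𝒯.k := ⟨𝒯.k_pos.ne'⟩
  refine forall_congr' fun i => ⟨?_, ?_⟩
  · rintro ⟨n, hn, hq⟩
    have h : (((q i).val : ℤ) : ZMod 𝒯.k) = (n : ZMod 𝒯.k) := by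
      rw [hq, Int.cast_natCast, ZMod.natCast_zmod_val]
    obtain ⟨l, hl⟩ := (ZMod.intCast_eq_intCast_iff_dvd_sub _ _ _).1 h
    refine ⟨l, ?_⟩
    rw [hn, show n = ((q i).val : ℤ) + 𝒯.k * l by linarith]
    push_cast
    rfl
  · rintro ⟨l, hl⟩
    refine ⟨(q i).val + 𝒯.k * l, by rw [hl]; push_cast; rfl, ?_⟩
    push_cast
    simp

theorem eq_of_mem_support {q q' : Fin g → ZMod 𝒯.k} {X : V} (h : X ∈ B.support q)
    (h' : X ∈ B.support q') : q = q' := by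
  funext i
  obtain ⟨n, hn, hq⟩ := h i
  obtain ⟨n', hn', hq'⟩ := h' i
  have : n = n' := by exact_mod_cast hn.symm.trans hn'
  rw [← hq, ← hq', this]

theorem exists_mem_support {X : V} (hX : X ∈ P.bsPoints) : ∃ q, X ∈ B.support q := by
  choose n hn using fun i => hX _ (B.W i).2 (B.W_mem i)
  exact ⟨fun i => n i, fun i => ⟨n i, hn i, rfl⟩⟩

/-- A point over the leaf that carries the section with index `q`. -/
noncomputable def point (q : Fin g → ZMod 𝒯.k) : V :=
  ∑ i, (((q i).val : ℝ) / 𝒯.k) • (B.Wp i : V)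

theorem k_ne_zero (𝒯 : SymplecticTorus g V) : (𝒯.k : ℝ) ≠ 0 := by exact_mod_cast 𝒯.k_pos.ne'

theorem omega_W_point (q : Fin g → ZMod 𝒯.k) (i : Fin g) :
    𝒯.ω (B.W i) (B.point q) = ((q i).val : ℝ) / 𝒯.k := by
  simp [point, B.pair_W_Wp]

theorem point_mem_support (q : Fin g → ZMod 𝒯.k) : B.point q ∈ B.support q := by
  rw [mem_support_iff]
  intro i
  refine ⟨0, ?_⟩
  rw [omega_W_point, mul_div_cancel₀ _ (k_ne_zero 𝒯)]
  simp

theorem osc_point (q : Fin g → ZMod 𝒯.k) : B.osc (B.point q) = 1 := by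
  have : B.potential (B.point q) = 0 := by
    simp [potential, point, B.pair_Wp_Wp]
  simp [osc, this]

/-- The functions `k ω(W i, X) mod k` separate these leaves: they are constant along `L`, and `Z`
moves `k ω(W i, X)` by multiples of `k`. Conversely, equal residues give a difference whose
`Wp`-coordinates are integers, hence an element of `L + Z`. -/
theorem leafOf_eq_iff (q : Fin g → ZMod 𝒯.k) (X : V) :
    P.leafOf X = P.leafOf (B.point q) ↔ X ∈ B.support q := by
  have hk := k_ne_zero 𝒯
  refine (Submodule.Quotient.eq _).trans ⟨fun h => ?_, fun h => ?_⟩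
  · obtain ⟨Y, hY, W, hW, e⟩ := Submodule.mem_sup.1 h
    rw [mem_support_iff]
    intro i
    obtain ⟨l, hl⟩ := (𝒯.selfDual _).1 (B.W i).2 _ hW
    refine ⟨l, ?_⟩
    have e' : X = B.point q + (Y + W) := by rw [e]; abel
    have hY0 : 𝒯.ω (B.W i) Y = 0 := B.omega_W_of_mem hY i
    rw [e', map_add, map_add, omega_W_point, hl, hY0]
    field_simp
    ring
  · rw [mem_support_iff] at h
    choose l hl using h
    rw [B.eq_sum (X - B.point q)]
    refine Submodule.add_mem_sup (Submodule.sum_mem P.L fun i _ => P.L.smul_mem _ (B.W_mem i))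
      (Submodule.sum_mem _ fun i _ => ?_)
    have : 𝒯.ω (B.W i) (X - B.point q) = l i := by
      rw [map_sub, omega_W_point]
      have := hl i
      field_simp
      linarith
    rw [this, Int.cast_smul_eq_zsmul]
    exact Submodule.smul_mem _ _ (B.Wp i).2

/-! ### The standard sections -/

theorem standardSection_of_mem {q : Fin g → ZMod 𝒯.k} {X : V} (h : X ∈ B.support q)
    (f : Fin g → P.L) : B.standardSection q X f = B.osc X * B.delta f := by
  rw [standardSection, if_pos (B.mem_support_iff.1 h), osc, Circle.coe_exp]
  congr 2
  push_cast
  ring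

theorem standardSection_of_notMem {q : Fin g → ZMod 𝒯.k} {X : V} (h : X ∉ B.support q)
    (f : Fin g → P.L) : B.standardSection q X f = 0 := by
  rw [standardSection, if_neg fun h' => h (B.mem_support_iff.2 h')]

theorem add_mem_support_iff {q : Fin g → ZMod 𝒯.k} {X Y : V}
    (hY : Y ∈ P.L.restrictScalars ℤ ⊔ 𝒯.Z) : X + Y ∈ B.support q ↔ X ∈ B.support q := by
  rw [← leafOf_eq_iff, ← leafOf_eq_iff]
  refine Eq.congr_left ((Submodule.Quotient.eq _).2 ?_)
  simpa using hY

theorem standardSection_add_of_mem (q : Fin g → ZMod 𝒯.k) (X : V) {Y : V} (hY : Y ∈ P.L)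
    (f : Fin g → P.L) :
    B.standardSection q (X + Y) f = 𝒯.mult X Y * B.standardSection q X f := by
  have hiff := B.add_mem_support_iff (q := q) (X := X)
    (Submodule.mem_sup_left (show Y ∈ P.L.restrictScalars ℤ from hY))
  by_cases h : X ∈ B.support q
  · rw [standardSection_of_mem B (hiff.2 h), standardSection_of_mem B h, B.osc_add_of_mem X hY,
      Circle.coe_mul, mul_assoc]
  · rw [standardSection_of_notMem B (fun h' => h (hiff.1 h')), standardSection_of_notMem B h,
      mul_zero]

theorem standardSection_add_lattice (q : Fin g → ZMod 𝒯.k) (X : V) {W : V} (hW : W ∈ 𝒯.Z)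
    (f : Fin g → P.L) :
    B.standardSection q (X + W) f = 𝒯.mult W X * B.standardSection q X f := by
  have hiff := B.add_mem_support_iff (q := q) (X := X) (Submodule.mem_sup_right hW)
  by_cases h : X ∈ B.support q
  · rw [standardSection_of_mem B (hiff.2 h), standardSection_of_mem B h, B.osc_add_lattice ?_ hW,
      Circle.coe_mul, mul_assoc]
    exact fun i => (h i).imp fun n hn => hn.1
  · rw [standardSection_of_notMem B (fun h' => h (hiff.1 h')), standardSection_of_notMem B h,
      mul_zero]

theorem standardSection_mem_leafSections (q : Fin g → ZMod 𝒯.k) :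
    B.standardSection q ∈ P.leafSections (P.leafOf (B.point q)) := by
  refine ⟨fun X f h => ?_, fun X a f => ?_,
    fun W hW X f => B.standardSection_add_lattice q X hW f, fun Y hY X f => ?_⟩
  · exact B.standardSection_of_notMem (fun h' => h ((B.leafOf_eq_iff q X).2 h')) f
  · by_cases h : X ∈ B.support q
    · rw [standardSection_of_mem B h, standardSection_of_mem B h]
      have := B.isHalfDensity_delta a f
      simp only at this
      rw [this]
      ring
    · rw [standardSection_of_notMem B h, standardSection_of_notMem B h, mul_zero]
  · have e : (fun t : ℝ => B.standardSection q (X + t • Y) f) = fun t : ℝ =>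
        Complex.exp (t * (2 * Real.pi * Complex.I * 𝒯.k * (𝒯.ω X Y / 2 : ℝ))) *
          B.standardSection q X f := by
      funext t
      rw [B.standardSection_add_of_mem q X (P.L.smul_mem t hY), coe_mult]
      congr 2
      rw [map_smul, smul_eq_mul]
      push_cast
      ring
    rw [e]
    have h0 := (((hasDerivAt_id (0 : ℝ)).ofReal_comp.mul_const
      (2 * Real.pi * Complex.I * 𝒯.k * (𝒯.ω X Y / 2 : ℝ))).cexp).mul_const
        (B.standardSection q X f)
    refine h0.congr_deriv ?_
    simp

theorem standardSection_basisL {q : Fin g → ZMod 𝒯.k} {X : V} (h : X ∈ B.support q) :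
    B.standardSection q X B.basisL = B.osc X := by
  rw [standardSection_of_mem B h, delta_basisL]; simp

theorem standardSection_mem_quantization (q : Fin g → ZMod 𝒯.k) :
    B.standardSection q ∈ P.quantization := by
  refine (le_iSup₂ (f := fun Λ (_ : P.IsBohrSommerfeld Λ) => P.leafSections Λ) _ ?_)
    (B.standardSection_mem_leafSections q)
  refine ⟨_, B.standardSection_mem_leafSections q, fun X hX h => ?_⟩
  have := congrFun h B.basisL
  rw [B.standardSection_basisL ((B.leafOf_eq_iff q X).1 hX)] at this
  exact Circle.coe_ne_zero _ this

theorem standardSection_mem_flatSections (q : Fin g → ZMod 𝒯.k) :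
    B.standardSection q ∈ P.flatSections :=
  P.quantization_le_flatSections (B.standardSection_mem_quantization q)

theorem standardSection_point (q q' : Fin g → ZMod 𝒯.k) :
    B.standardSection q (B.point q') B.basisL = if q = q' then 1 else 0 := by
  split_ifs with h
  · subst h
    rw [B.standardSection_basisL (B.point_mem_support q), osc_point, Circle.coe_one]
  · exact B.standardSection_of_notMem
      (fun h' => h (B.eq_of_mem_support h' (B.point_mem_support q'))) _

/-- Away from the Bohr–Sommerfeld leaves all terms vanish. Over the leaf of `q` only `σ_q` survives,
and the common factor together with the half-density rule reduces the comparison to the point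
`B.point q` and the frame `B.basisL`, where `σ_q` is `1`. -/
theorem eq_sum_standardSection [NeZero 𝒯.k] {ψ : P.Amplitude} (hψ : ψ ∈ P.flatSections) :
    ψ = ∑ q, ψ (B.point q) B.basisL • B.standardSection q := by
  funext X f
  rw [Finset.sum_apply, Finset.sum_apply]
  simp only [Pi.smul_apply, smul_eq_mul]
  by_cases hX : X ∈ P.bsPoints
  · obtain ⟨q, hq⟩ := B.exists_mem_support hX
    rw [Finset.sum_eq_single q]
    · obtain ⟨z, hz⟩ := P.exists_common_factor ((B.leafOf_eq_iff q X).2 hq)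
      rw [hz ψ hψ, hz _ (B.standardSection_mem_flatSections q),
        standardSection_of_mem B (B.point_mem_support q), osc_point, Circle.coe_one,
        B.halfDensity_eq (hψ.1 _) f]
      ring
    · intro q' _ hne
      rw [B.standardSection_of_notMem fun h => hne (B.eq_of_mem_support h hq), mul_zero]
    · simp
  · have h0 : ∀ φ ∈ P.flatSections, φ X f = 0 := fun φ hφ => by
      by_contra h
      exact hX (mem_bsPoints_of_ne_zero hφ h)
    rw [h0 ψ hψ]
    refine (Finset.sum_eq_zero fun q _ => ?_).symm
    rw [h0 _ (B.standardSection_mem_flatSections q), mul_zero]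

/-! ### The orthonormal basis of standard sections -/

theorem linearIndependent_standardSection [NeZero 𝒯.k] : LinearIndependent ℂ
    (fun q => (⟨B.standardSection q, B.standardSection_mem_quantization q⟩ :
      P.quantization)) := by
  rw [Fintype.linearIndependent_iff]
  intro c hc q'
  have h1 := congrArg (fun ψ : P.quantization => (ψ : P.Amplitude) (B.point q') B.basisL) hc
  simp only [Submodule.coe_sum, Submodule.coe_smul, Finset.sum_apply, Pi.smul_apply,
    smul_eq_mul, standardSection_point] at h1
  simpa using h1

/-- The standard basis of the space of quantization. -/
noncomputable def standardBasis [NeZero 𝒯.k] :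
    Module.Basis (Fin g → ZMod 𝒯.k) ℂ P.quantization :=
  Module.Basis.mk B.linearIndependent_standardSection (by
    rintro ψ -
    have h : ψ = ∑ q, (ψ : P.Amplitude) (B.point q) B.basisL •
        (⟨B.standardSection q, B.standardSection_mem_quantization q⟩ : P.quantization) := by
      refine Subtype.ext ?_
      rw [Submodule.coe_sum]
      exact B.eq_sum_standardSection (P.quantization_le_flatSections ψ.2)
    rw [h]
    exact Submodule.sum_mem _ fun q _ => Submodule.smul_mem _ _ (Submodule.subset_span ⟨q, rfl⟩))

theorem coe_standardBasis [NeZero 𝒯.k] (q : Fin g → ZMod 𝒯.k) :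
    (B.standardBasis q : P.Amplitude) = B.standardSection q := by
  rw [standardBasis, Module.Basis.mk_apply]

theorem innerProd_standardSection (q q' : Fin g → ZMod 𝒯.k) :
    P.innerProd (B.standardSection q) (B.standardSection q') = if q = q' then 1 else 0 := by
  rw [innerProd_eq_leafSum (B.standardSection_mem_flatSections q)
    (B.standardSection_mem_flatSections q'), leafSum]
  split_ifs with h
  · subst h
    rw [finsum_eq_single _ (P.leafOf (B.point q))]
    · have hm : Quotient.out (P.leafOf (B.point q)) ∈ B.support q :=
        (B.leafOf_eq_iff q _).1 (mk_out _ _)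
      rw [standardSection_of_mem B hm, delta_latticeBasis, Complex.ofReal_one, mul_one,
        ← Complex.normSq_eq_conj_mul_self, Circle.normSq_coe, Complex.ofReal_one]
    · intro Λ hΛ
      have hm : Quotient.out Λ ∉ B.support q := fun h =>
        hΛ (((B.leafOf_eq_iff q _).2 h).symm.trans (mk_out _ _)).symm
      rw [standardSection_of_notMem B hm, mul_zero]
  · refine finsum_eq_zero_of_forall_eq_zero fun Λ => ?_
    by_cases hm : Quotient.out Λ ∈ B.support q
    · rw [B.standardSection_of_notMem (q := q') fun h' => h (B.eq_of_mem_support hm h'), mul_zero]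
    · rw [B.standardSection_of_notMem hm, map_zero, zero_mul]

/-! ### The action of the Heisenberg group in the standard basis -/

/-- The translation is along `L`, so flatness brings the value back to `X`. The total factor is `e ^
(2 π i ω(W i, X))`, and `k ω(W i, X) ≡ q i mod k` on the support. -/
theorem translation_W (z : Circle) (i : Fin g) (q : Fin g → ZMod 𝒯.k) :
    P.translation ⟨z, 𝒯.divLevel (B.W i)⟩ (B.standardSection q) =
      ((z : ℂ) * Complex.exp (2 * Real.pi * Complex.I * ((q i).val : ℂ) / 𝒯.k)) •
        B.standardSection q := by
  have hk := k_ne_zero 𝒯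
  funext X f
  set Y : V := (𝒯.k : ℝ)⁻¹ • (B.W i : V) with hY
  have hYL : -Y ∈ P.L := P.L.neg_mem (P.L.smul_mem _ (B.W_mem i))
  change (z : ℂ) * (𝒯.mult Y (X - Y) * B.standardSection q (X - Y) f) =
    ((z : ℂ) * Complex.exp (2 * Real.pi * Complex.I * ((q i).val : ℂ) / 𝒯.k)) *
      B.standardSection q X f
  rw [sub_eq_add_neg, B.standardSection_add_of_mem q X hYL]
  by_cases h : X ∈ B.support q
  · obtain ⟨l, hl⟩ := B.mem_support_iff.1 h i
    have hm : 𝒯.mult Y (X + -Y) * 𝒯.mult X (-Y) =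
        Circle.exp (2 * Real.pi * ((q i).val / 𝒯.k)) := by
      rw [mult, mult, ← Circle.exp_add, Circle.exp_eq_exp]
      refine ⟨l, ?_⟩
      rw [map_add, map_neg, map_neg, 𝒯.isAlt Y, 𝒯.skew X Y, hY, map_smul, LinearMap.smul_apply,
        smul_eq_mul]
      field_simp
      linear_combination 2 * hl
    have hm' := congrArg (fun c : Circle => (c : ℂ)) hm
    simp only [Circle.coe_mul, Circle.coe_exp] at hm'
    have e : 2 * Real.pi * Complex.I * ((q i).val : ℂ) / 𝒯.k =
        ((2 * Real.pi * ((q i).val / 𝒯.k) : ℝ) : ℂ) * Complex.I := by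
      push_cast
      ring
    rw [e, ← hm']
    ring
  · rw [standardSection_of_notMem B h]; ring

/-- As `k ω(W j, Y) = δ_ij` for `Y = (1 / k) Wp i`, the translation carries the leaf of `q` to that
of `q + e_i`. No phase appears: `K(X - Y) = K(X) - ω(X, Y) / 2`, and the last term compensates the
multiplier. -/
theorem translation_Wp (z : Circle) (i : Fin g) (q : Fin g → ZMod 𝒯.k) :
    P.translation ⟨z, 𝒯.divLevel (B.Wp i)⟩ (B.standardSection q) =
      (z : ℂ) • B.standardSection (q + Pi.single i 1) := by
  have hk := k_ne_zero 𝒯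
  funext X f
  set Y : V := (𝒯.k : ℝ)⁻¹ • (B.Wp i : V) with hY
  change (z : ℂ) * (𝒯.mult Y (X - Y) * B.standardSection q (X - Y) f) =
    (z : ℂ) * B.standardSection (q + Pi.single i 1) X f
  have hWY : ∀ j, 𝒯.k * 𝒯.ω (B.W j) Y = ((if j = i then 1 else 0 : ℤ) : ℝ) := fun j => by
    rw [hY, map_smul, smul_eq_mul, B.pair_W_Wp, mul_inv_cancel_left₀ hk]
    split_ifs <;> simp
  have hiff : X - Y ∈ B.support q ↔ X ∈ B.support (q + Pi.single i 1) := by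
    have hs : ∀ j, ((if j = i then 1 else 0 : ℤ) : ZMod 𝒯.k) =
        (Pi.single i 1 : Fin g → ZMod 𝒯.k) j := fun j => by
      rw [Pi.single_apply]; split_ifs <;> simp
    refine forall_congr' fun j => ⟨?_, ?_⟩
    · rintro ⟨n, hn, hq⟩
      refine ⟨n + (if j = i then 1 else 0 : ℤ), ?_, ?_⟩
      · rw [map_sub, mul_sub, hWY] at hn
        rw [Int.cast_add, ← hn]; ring
      · rw [Int.cast_add, hq, hs]; rfl
    · rintro ⟨n, hn, hq⟩
      refine ⟨n - (if j = i then 1 else 0 : ℤ), ?_, ?_⟩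
      · rw [map_sub, mul_sub, hWY, hn, Int.cast_sub]
      · rw [Int.cast_sub, hq, hs, Pi.add_apply, add_sub_cancel_right]
  by_cases h : X ∈ B.support (q + Pi.single i 1)
  · rw [standardSection_of_mem B h, standardSection_of_mem B (hiff.2 h)]
    have hpot : B.potential (X - Y) = B.potential X - 𝒯.ω X Y / 2 := by
      have h1 := B.potential_add X (-Y)
      have h2 : ∀ j, 𝒯.ω Y (B.Wp j) = 0 := fun j => by
        rw [hY, map_smul, LinearMap.smul_apply, B.pair_Wp_Wp, smul_zero]
      have h3 : B.potential (-Y) = 0 := by simp [potential, h2]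
      rw [← sub_eq_add_neg, h3] at h1
      rw [h1]
      simp [h2]
      ring
    have hm : 𝒯.mult Y (X - Y) * B.osc (X - Y) = B.osc X := by
      rw [mult, osc, osc, ← Circle.exp_add, hpot, map_sub, 𝒯.isAlt Y, 𝒯.skew X Y]
      congr 1
      ring
    rw [← hm, Circle.coe_mul]
    ring
  · rw [standardSection_of_notMem B h, standardSection_of_notMem B (fun h' => h (hiff.1 h')),
      mul_zero]

end AdaptedBasis

end Polarization

end SymplecticTorus

namespace SymplecticTorus

variable {g : ℕ} {V : Type*} [AddCommGroup V] [Module ℝ V]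

/-! ### Finiteness of the set of relevant leaves -/

theorem finite_lattice (𝒯 : SymplecticTorus g V) {N : Submodule ℤ V} (hN : N ≤ 𝒯.Z) :
    Module.Finite ℤ N := by
  obtain ⟨b, hb⟩ := 𝒯.isLattice
  have hfin : Module.Finite ℤ 𝒯.Z := by
    rw [hb]; exact Module.Finite.of_basis (b.restrictScalars ℤ)
  exact Module.Finite.of_injective (Submodule.inclusion hN) (Submodule.inclusion_injective hN)

theorem finite_quotient_of_isTorsion {M : Type*} [AddCommGroup M] [Module.Finite ℤ M]
    {N : Submodule ℤ M} {n : ℕ} (hn : n ≠ 0) (h : ∀ x : M, (n : ℤ) • x ∈ N) : Finite (M ⧸ N) := by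
  refine Module.finite_of_fg_torsion _ fun x => ?_
  obtain ⟨x, rfl⟩ := Submodule.Quotient.mk_surjective N x
  refine ⟨⟨n, mem_nonZeroDivisors_of_ne_zero (by exact_mod_cast hn)⟩, ?_⟩
  exact (Submodule.Quotient.mk_eq_zero N).2 (h x)

/-- If `n X = Y + W` with `Y ∈ K` and `W ∈ Z`, the class of `X` is that of `W / n`, which depends
only on `W` modulo `n Z`; and `Z / n Z` is finite. -/
theorem finite_torsion_leaves (𝒯 : SymplecticTorus g V) (K : Submodule ℝ V) {n : ℕ} (hn : n ≠ 0) :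
    {C : V ⧸ (K.restrictScalars ℤ ⊔ 𝒯.Z) |
      ∃ X, Submodule.Quotient.mk X = C ∧ n • X ∈ K.restrictScalars ℤ ⊔ 𝒯.Z}.Finite := by
  have hfin : Module.Finite ℤ 𝒯.Z := 𝒯.finite_lattice le_rfl
  have hn' : (n : ℝ) ≠ 0 := by exact_mod_cast hn
  let N : Submodule ℤ 𝒯.Z := LinearMap.range ((n : ℤ) • (LinearMap.id : 𝒯.Z →ₗ[ℤ] 𝒯.Z))
  have hN : Finite (𝒯.Z ⧸ N) := finite_quotient_of_isTorsion hn fun x => ⟨x, rfl⟩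
  refine (Set.finite_range fun c : 𝒯.Z ⧸ N => (Submodule.Quotient.mk
    ((n : ℝ)⁻¹ • ((Quotient.out c : 𝒯.Z) : V)) : V ⧸ (K.restrictScalars ℤ ⊔ 𝒯.Z))).subset ?_
  rintro _ ⟨X, rfl, hX⟩
  obtain ⟨Y, hY, W, hW, e⟩ := Submodule.mem_sup.1 hX
  refine ⟨Submodule.Quotient.mk ⟨W, hW⟩, ?_⟩
  have h := mk_out N (Submodule.Quotient.mk ⟨W, hW⟩)
  obtain ⟨z, hz⟩ := (Submodule.Quotient.eq N).1 h
  have hz' : (n : ℝ) • (z : V) =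
      (Quotient.out (Submodule.Quotient.mk ⟨W, hW⟩ : 𝒯.Z ⧸ N) : 𝒯.Z) - W := by
    have := congrArg (fun z : 𝒯.Z => (z : V)) hz
    simpa [← Nat.cast_smul_eq_nsmul ℝ] using this
  refine (Submodule.Quotient.eq _).2 ?_
  have e2 : (n : ℝ)⁻¹ • ((Quotient.out (Submodule.Quotient.mk ⟨W, hW⟩ : 𝒯.Z ⧸ N) : 𝒯.Z) : V) - X =
      -((n : ℝ)⁻¹ • Y) + z := by
    have e3 : (n : ℝ) • X = Y + W := by rw [e, Nat.cast_smul_eq_nsmul]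
    have e4 : X = (n : ℝ)⁻¹ • (Y + W) := by rw [← e3, inv_smul_smul₀ hn']
    have e5 : (z : V) = (n : ℝ)⁻¹ • ((n : ℝ) • (z : V)) := by rw [inv_smul_smul₀ hn']
    rw [e5, hz', e4, smul_sub, smul_add]
    abel
  rw [e2]
  exact Submodule.add_mem_sup (K.neg_mem (K.smul_mem _ hY)) z.2

namespace Polarization

variable {𝒯 : SymplecticTorus g V}

theorem nsmul_mem_of_mem_bsPoints (P : 𝒯.Polarization) {X : V} (hX : X ∈ P.bsPoints) :
    𝒯.k • X ∈ P.L.restrictScalars ℤ ⊔ 𝒯.Z := by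
  obtain ⟨B⟩ := P.adaptedBasis_nonempty
  rw [B.eq_sum X, smul_add, Finset.smul_sum, Finset.smul_sum]
  refine Submodule.add_mem_sup (Submodule.sum_mem P.L fun i _ => ?_)
    (Submodule.sum_mem _ fun i _ => ?_)
  · exact P.L.smul_of_tower_mem _ (P.L.smul_mem _ (B.W_mem i))
  · obtain ⟨n, hn⟩ := hX _ (B.W i).2 (B.W_mem i)
    rw [← Nat.cast_smul_eq_nsmul ℝ, smul_smul, hn, Int.cast_smul_eq_zsmul]
    exact Submodule.smul_mem _ _ (Submodule.coe_mem _)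

/-- By rationality, `(L₁ ∩ Z) + (L₂ ∩ Z)` and `(L₁ + L₂) ∩ Z` span the same real space, so they have
equal rank and the index is finite; `e` is that index. -/
theorem exists_nsmul_mem_sup (P₂ P₁ : 𝒯.Polarization) : ∃ e : ℕ, e ≠ 0 ∧
    ∀ X ∈ P₁.L ⊔ P₂.L, X ∈ 𝒯.Z →
      e • X ∈ (P₁.L.restrictScalars ℤ ⊓ 𝒯.Z) ⊔ (P₂.L.restrictScalars ℤ ⊓ 𝒯.Z) := by
  have hfd := 𝒯.finiteDimensional
  obtain ⟨b, hb⟩ := 𝒯.isLattice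
  set N : Submodule ℤ V := (P₁.L.restrictScalars ℤ ⊓ 𝒯.Z) ⊔ (P₂.L.restrictScalars ℤ ⊓ 𝒯.Z)
    with hN
  let M : Submodule ℤ V := (P₁.L ⊔ P₂.L).restrictScalars ℤ ⊓ 𝒯.Z
  have hle : N ≤ M := by
    refine sup_le (inf_le_inf_right _ ?_) (inf_le_inf_right _ ?_)
    · exact fun x hx => (le_sup_left : P₁.L ≤ P₁.L ⊔ P₂.L) hx
    · exact fun x hx => (le_sup_right : P₂.L ≤ P₁.L ⊔ P₂.L) hx
  have hMZ : M ≤ 𝒯.Z := inf_le_right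
  have fM := 𝒯.finite_lattice hMZ
  have rM := finrank_span_int b M (hb ▸ hMZ)
  have rN := finrank_span_int b N (hb ▸ hle.trans hMZ)
  have hspan : P₁.L ⊔ P₂.L ≤ Submodule.span ℝ (N : Set V) := by
    refine sup_le ?_ ?_
    · rw [← P₁.rational]
      exact Submodule.span_mono fun x hx => (le_sup_left : _ ≤ N) hx
    · rw [← P₂.rational]
      exact Submodule.span_mono fun x hx => (le_sup_right : _ ≤ N) hx
  have hspanM : Submodule.span ℝ (M : Set V) ≤ P₁.L ⊔ P₂.L := Submodule.span_le.2 fun x hx => hx.1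
  have hr : Module.finrank ℤ M ≤ Module.finrank ℤ N := by
    rw [← rM, ← rN]
    exact Submodule.finrank_mono (hspanM.trans hspan)
  let N' : Submodule ℤ M := N.comap M.subtype
  have hN' : Module.finrank ℤ N' = Module.finrank ℤ N :=
    (Submodule.comapSubtypeEquivOfLe hle).finrank_eq
  have hq := N'.finrank_quotient_add_finrank
  have hfinite : Finite (M ⧸ N') :=
    Module.finite_of_fg_torsion _ (Module.finrank_eq_zero_iff_isTorsion.1 (by omega))
  refine ⟨Nat.card (M ⧸ N'), Nat.card_pos.ne', fun X hX hXZ => ?_⟩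
  have h0 : Nat.card (M ⧸ N') • (Submodule.Quotient.mk ⟨X, hX, hXZ⟩ : M ⧸ N') = 0 :=
    card_nsmul_eq_zero'
  rw [← Submodule.Quotient.mk_smul, Submodule.Quotient.mk_eq_zero] at h0
  exact h0

/-- If `k X = Y₁ + W₁ = Y₂ + W₂`, then `Y₁ - Y₂` is a lattice vector of `L₁ + L₂`, so `e (Y₁ - Y₂) =
m₁ + m₂` with `m_a ∈ L_a ∩ Z`. Then `e Y₁ - m₁ = e Y₂ + m₂` lies in `L₁ ∩ L₂`, which makes the class
of `X` torsion of order dividing `e k`. -/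
theorem finite_bsLeaves (P₂ P₁ : 𝒯.Polarization) :
    {C : V ⧸ ((P₁.L ⊓ P₂.L).restrictScalars ℤ ⊔ 𝒯.Z) |
      ∃ X, Submodule.Quotient.mk X = C ∧ X ∈ P₁.bsPoints ∧ X ∈ P₂.bsPoints}.Finite := by
  obtain ⟨e, he, h⟩ := exists_nsmul_mem_sup P₂ P₁
  refine (𝒯.finite_torsion_leaves (P₁.L ⊓ P₂.L) (mul_ne_zero he 𝒯.k_pos.ne')).subset ?_
  rintro _ ⟨X, rfl, h₁, h₂⟩
  refine ⟨X, rfl, ?_⟩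
  obtain ⟨Y₁, hY₁, W₁, hW₁, e₁⟩ := Submodule.mem_sup.1 (P₁.nsmul_mem_of_mem_bsPoints h₁)
  obtain ⟨Y₂, hY₂, W₂, hW₂, e₂⟩ := Submodule.mem_sup.1 (P₂.nsmul_mem_of_mem_bsPoints h₂)
  have hd : Y₁ - Y₂ = W₂ - W₁ := by
    rw [sub_eq_sub_iff_add_eq_add, e₁, ← e₂, add_comm]
  have hmem : e • (Y₁ - Y₂) ∈
      (P₁.L.restrictScalars ℤ ⊓ 𝒯.Z) ⊔ (P₂.L.restrictScalars ℤ ⊓ 𝒯.Z) := by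
    refine h _ (sub_eq_add_neg Y₁ Y₂ ▸ Submodule.add_mem_sup hY₁ (P₂.L.neg_mem hY₂)) ?_
    rw [hd]
    exact 𝒯.Z.sub_mem hW₂ hW₁
  obtain ⟨m₁, hm₁, m₂, hm₂, hm⟩ := Submodule.mem_sup.1 hmem
  have e₃ : e • Y₁ - m₁ = e • Y₂ + m₂ := by
    rw [smul_sub] at hm
    rw [sub_eq_iff_eq_add, add_assoc, add_comm m₂, hm]
    abel
  have hK : e • Y₁ - m₁ ∈ P₁.L ⊓ P₂.L := by
    refine ⟨P₁.L.sub_mem (P₁.L.smul_of_tower_mem _ hY₁) hm₁.1, ?_⟩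
    rw [e₃]
    exact P₂.L.add_mem (P₂.L.smul_of_tower_mem _ hY₂) hm₂.1
  have e₄ : (e * 𝒯.k) • X = (e • Y₁ - m₁) + (m₁ + e • W₁) := by
    rw [mul_smul, ← e₁, smul_add]
    abel
  rw [e₄]
  exact Submodule.add_mem_sup hK (𝒯.Z.add_mem hm₁.2 (𝒯.Z.smul_of_tower_mem _ hW₁))

/-! ### The inner product and the pairing as sesquilinear forms -/

theorem leafSum_pairing_add {K : Submodule ℝ V} {P₂ P₁ : 𝒯.Polarization}
    (hfin : {C : V ⧸ (K.restrictScalars ℤ ⊔ 𝒯.Z) |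
      ∃ X, Submodule.Quotient.mk X = C ∧ X ∈ P₁.bsPoints ∧ X ∈ P₂.bsPoints}.Finite)
    {ψ₂ φ₂ : P₂.Amplitude} {ψ₁ φ₁ : P₁.Amplitude} (hψ₂ : ψ₂ ∈ P₂.flatSections)
    (hφ₂ : φ₂ ∈ P₂.flatSections) (hψ₁ : ψ₁ ∈ P₁.flatSections) (hφ₁ : φ₁ ∈ P₁.flatSections)
    (f₂ : Fin g → P₂.L) (f₁ : Fin g → P₁.L) :
    𝒯.leafSum K (fun X => (starRingEnd ℂ) (ψ₂ X f₂) * ψ₁ X f₁ +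
        (starRingEnd ℂ) (φ₂ X f₂) * φ₁ X f₁) =
      𝒯.leafSum K (fun X => (starRingEnd ℂ) (ψ₂ X f₂) * ψ₁ X f₁) +
        𝒯.leafSum K (fun X => (starRingEnd ℂ) (φ₂ X f₂) * φ₁ X f₁) := by
  have key : ∀ {ψ₂ : P₂.Amplitude} {ψ₁ : P₁.Amplitude}, ψ₂ ∈ P₂.flatSections →
      ψ₁ ∈ P₁.flatSections → ∀ X, (starRingEnd ℂ) (ψ₂ X f₂) * ψ₁ X f₁ ≠ 0 →
      X ∈ P₁.bsPoints ∧ X ∈ P₂.bsPoints := fun h2 h1 X h =>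
    ⟨mem_bsPoints_of_ne_zero h1 (right_ne_zero_of_mul h),
      mem_bsPoints_of_ne_zero h2 fun h0 => left_ne_zero_of_mul h (by rw [h0, map_zero])⟩
  exact leafSum_add hfin (fun X h => ⟨X, rfl, key hψ₂ hψ₁ X h⟩)
    (fun X h => ⟨X, rfl, key hφ₂ hφ₁ X h⟩)

/-- The sum over the classes modulo `K + Z` of the pairings of two flat sections, as a
sesquilinear form. -/
noncomputable def leafForm {K : Submodule ℝ V} {P₂ P₁ : 𝒯.Polarization}
    (hfin : {C : V ⧸ (K.restrictScalars ℤ ⊔ 𝒯.Z) |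
      ∃ X, Submodule.Quotient.mk X = C ∧ X ∈ P₁.bsPoints ∧ X ∈ P₂.bsPoints}.Finite)
    (f₂ : Fin g → P₂.L) (f₁ : Fin g → P₁.L) :
    P₂.quantization →ₗ⋆[ℂ] P₁.quantization →ₗ[ℂ] ℂ :=
  LinearMap.mk₂'ₛₗ (starRingEnd ℂ) (RingHom.id ℂ)
    (fun ψ₂ ψ₁ => 𝒯.leafSum K (fun X => (starRingEnd ℂ) ((ψ₂ : P₂.Amplitude) X f₂) *
      (ψ₁ : P₁.Amplitude) X f₁))
    (fun ψ₂ φ₂ ψ₁ => by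
      rw [← leafSum_pairing_add hfin (P₂.quantization_le_flatSections ψ₂.2)
        (P₂.quantization_le_flatSections φ₂.2) (P₁.quantization_le_flatSections ψ₁.2)
        (P₁.quantization_le_flatSections ψ₁.2)]
      simp [add_mul])
    (fun c ψ₂ ψ₁ => by
      rw [smul_eq_mul, ← leafSum_const_mul]
      simp [mul_assoc])
    (fun ψ₂ ψ₁ φ₁ => by
      rw [← leafSum_pairing_add hfin (P₂.quantization_le_flatSections ψ₂.2)
        (P₂.quantization_le_flatSections ψ₂.2) (P₁.quantization_le_flatSections ψ₁.2)
        (P₁.quantization_le_flatSections φ₁.2)]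
      simp [mul_add])
    (fun c ψ₂ ψ₁ => by
      rw [smul_eq_mul, RingHom.id_apply, ← leafSum_const_mul]
      simp [mul_left_comm])

theorem finite_bsLeaves_self (P : 𝒯.Polarization) :
    {C : V ⧸ (P.L.restrictScalars ℤ ⊔ 𝒯.Z) |
      ∃ X, Submodule.Quotient.mk X = C ∧ X ∈ P.bsPoints ∧ X ∈ P.bsPoints}.Finite := by
  refine (𝒯.finite_torsion_leaves P.L 𝒯.k_pos.ne').subset ?_
  rintro _ ⟨X, rfl, h, -⟩
  exact ⟨X, rfl, P.nsmul_mem_of_mem_bsPoints h⟩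

/-- The inner product of the space of quantization as a sesquilinear form. -/
noncomputable def innerForm (P : 𝒯.Polarization) :
    P.quantization →ₗ⋆[ℂ] P.quantization →ₗ[ℂ] ℂ :=
  leafForm P.finite_bsLeaves_self P.latticeBasis P.latticeBasis

theorem innerForm_apply (P : 𝒯.Polarization) (ψ φ : P.quantization) :
    P.innerForm ψ φ = P.innerProd ψ φ :=
  (innerProd_eq_leafSum (P.quantization_le_flatSections ψ.2)
    (P.quantization_le_flatSections φ.2)).symm

/-- The Blattner–Kostant–Sternberg pairing as a sesquilinear form. -/
noncomputable def bksForm (P₂ P₁ : 𝒯.Polarization) :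
    P₂.quantization →ₗ⋆[ℂ] P₁.quantization →ₗ[ℂ] ℂ :=
  leafForm (finite_bsLeaves P₂ P₁) (pairingFrame P₂ P₁).U₂ (pairingFrame P₂ P₁).U₁

theorem bksForm_apply (P₂ P₁ : 𝒯.Polarization) (ψ₂ : P₂.quantization) (ψ₁ : P₁.quantization) :
    bksForm P₂ P₁ ψ₂ ψ₁ = bksPairing P₂ P₁ ψ₂ ψ₁ :=
  (bksPairing_eq_leafSum (P₂.quantization_le_flatSections ψ₂.2)
    (P₁.quantization_le_flatSections ψ₁.2)).symm

namespace AdaptedBasis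

variable {P : 𝒯.Polarization} (B : P.AdaptedBasis) [NeZero 𝒯.k]

theorem innerForm_standardBasis (q q' : Fin g → ZMod 𝒯.k) :
    P.innerForm (B.standardBasis q) (B.standardBasis q') = if q = q' then 1 else 0 := by
  rw [innerForm_apply, coe_standardBasis, coe_standardBasis, innerProd_standardSection]

theorem innerForm_standardBasis_left (q : Fin g → ZMod 𝒯.k) (φ : P.quantization) :
    P.innerForm (B.standardBasis q) φ = B.standardBasis.repr φ q := by
  conv_lhs => rw [← B.standardBasis.sum_repr φ]
  simp only [map_sum, map_smul, innerForm_standardBasis, smul_eq_mul, mul_ite, mul_one, mul_zero,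
    Finset.sum_ite_eq, Finset.mem_univ, if_true]

theorem eq_of_innerForm (B : P.AdaptedBasis) {φ φ' : P.quantization}
    (h : ∀ ψ, P.innerForm ψ φ = P.innerForm ψ φ') : φ = φ' :=
  Module.Basis.ext_elem B.standardBasis fun q => by
    rw [← innerForm_standardBasis_left, ← innerForm_standardBasis_left, h]

/-- The linear map into the space of quantization that represents a sesquilinear form. -/
noncomputable def represent {E : Type*} [AddCommGroup E] [Module ℂ E]
    (β : P.quantization →ₗ⋆[ℂ] E →ₗ[ℂ] ℂ) : E →ₗ[ℂ] P.quantization :=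
  ∑ q, (β (B.standardBasis q)).smulRight (B.standardBasis q)

/-- Both sides are conjugate linear in `ψ`, so orthonormality settles the identity on the standard
basis. -/
theorem innerForm_represent {E : Type*} [AddCommGroup E] [Module ℂ E]
    (β : P.quantization →ₗ⋆[ℂ] E →ₗ[ℂ] ℂ) (ψ : P.quantization) (φ : E) :
    P.innerForm ψ (B.represent β φ) = β ψ φ := by
  have h : ∀ q, P.innerForm (B.standardBasis q) (B.represent β φ) = β (B.standardBasis q) φ := by
    simp [represent, innerForm_standardBasis]
  conv_lhs => rw [← B.standardBasis.sum_repr ψ]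
  conv_rhs => rw [← B.standardBasis.sum_repr ψ]
  simp only [map_sum, map_smulₛₗ, LinearMap.sum_apply, LinearMap.smul_apply, h]

end AdaptedBasis

/-! ### The operator induced by the pairing -/

theorem existsUnique_isBKSOperator (P₂ P₁ : 𝒯.Polarization) :
    ∃! F : P₁.quantization →ₗ[ℂ] P₂.quantization, P₂.IsBKSOperator P₁ F := by
  have : NeZero 𝒯.k := ⟨𝒯.k_pos.ne'⟩
  obtain ⟨B⟩ := P₂.adaptedBasis_nonempty
  refine ⟨B.represent (bksForm P₂ P₁), fun ψ₁ ψ₂ => ?_, fun F hF => LinearMap.ext fun ψ₁ =>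
    B.eq_of_innerForm fun ψ₂ => ?_⟩
  · rw [← innerForm_apply, B.innerForm_represent, bksForm_apply]
  · rw [B.innerForm_represent, bksForm_apply, innerForm_apply, hF]

theorem IsBKSOperator.isIntertwiningMap {P₂ P₁ : 𝒯.Polarization}
    {F : P₁.quantization →ₗ[ℂ] P₂.quantization} (hF : P₂.IsBKSOperator P₁ F) :
    P₁.heisenbergRep.IsIntertwiningMap P₂.heisenbergRep F := by
  have : NeZero 𝒯.k := ⟨𝒯.k_pos.ne'⟩
  obtain ⟨B⟩ := P₂.adaptedBasis_nonempty
  refine ⟨fun x ψ₁ => B.eq_of_innerForm fun ψ₂ => ?_⟩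
  -- Since `x` acts invertibly, it suffices to test against vectors `x φ`: `⟨x φ, F x ψ⟩ = ⟨⟨x φ, x
  -- ψ⟩⟩ = ⟨⟨φ, ψ⟩⟩ = ⟨φ, F ψ⟩ = ⟨x φ, x F ψ⟩`.
  obtain ⟨φ, rfl⟩ : ∃ φ, P₂.heisenbergRep x φ = ψ₂ :=
    ⟨P₂.heisenbergRep x⁻¹ ψ₂, P₂.heisenbergRep.self_inv_apply x ψ₂⟩
  rw [innerForm_apply, innerForm_apply, hF, bksPairing_heisenbergRep, innerProd_heisenbergRep, hF]

end Polarization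

end SymplecticTorus

/-! ### The theorem -/

theorem mainTheorem6 {g : ℕ} {V : Type*} [AddCommGroup V] [Module ℝ V]
    (𝒯 : SymplecticTorus g V) :
    -- `H_k` is a central extension of `Z_k` by the circle
    (Function.Injective 𝒯.circleInclusion ∧ Function.Surjective 𝒯.projection ∧
      𝒯.circleInclusion.range = 𝒯.projection.ker ∧
      𝒯.circleInclusion.range ≤ Subgroup.center 𝒯.Heisenberg) ∧
    -- it acts unitarily on each `H_P`, by shift and phase operators in the standard bases
    (∀ P : 𝒯.Polarization,
      (∀ (x : 𝒯.Heisenberg) (ψ φ : P.quantization),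
        P.innerProd (P.heisenbergRep x ψ) (P.heisenbergRep x φ) = P.innerProd ψ φ) ∧
      (∀ (z : Circle) (ψ : P.quantization),
        P.heisenbergRep (𝒯.circleInclusion z) ψ = (z : ℂ) • ψ) ∧
      Nonempty P.AdaptedBasis ∧
      ∀ B : P.AdaptedBasis,
        ∃ σ : Module.Basis (Fin g → ZMod 𝒯.k) ℂ P.quantization,
          (∀ q, (σ q : P.Amplitude) = B.standardSection q) ∧
          (∀ q q', P.innerProd (σ q) (σ q') = if q = q' then 1 else 0) ∧
          (∀ (z : Circle) (i : Fin g) (q : Fin g → ZMod 𝒯.k),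
            P.heisenbergRep (𝒯.heis z (𝒯.divLevel (B.W i))) (σ q) =
              ((z : ℂ) * Complex.exp (2 * Real.pi * Complex.I * ((q i).val : ℂ) / 𝒯.k)) • σ q) ∧
          (∀ (z : Circle) (i : Fin g) (q : Fin g → ZMod 𝒯.k),
            P.heisenbergRep (𝒯.heis z (𝒯.divLevel (B.Wp i))) (σ q) =
              (z : ℂ) • σ (q + Pi.single i 1))) ∧
    -- the operator induced by the pairing exists, is unique, and intertwines
    (∀ P₁ P₂ : 𝒯.Polarization,
      (∃! F : P₁.quantization →ₗ[ℂ] P₂.quantization, P₂.IsBKSOperator P₁ F) ∧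
      ∀ F : P₁.quantization →ₗ[ℂ] P₂.quantization, P₂.IsBKSOperator P₁ F →
        P₁.heisenbergRep.IsIntertwiningMap P₂.heisenbergRep F) := by
  have : NeZero 𝒯.k := ⟨𝒯.k_pos.ne'⟩
  refine ⟨⟨𝒯.circleInclusion_injective, 𝒯.projection_surjective, 𝒯.range_circleInclusion,
    𝒯.range_circleInclusion_le_center⟩, fun P => ⟨P.innerProd_heisenbergRep,
    P.heisenbergRep_circleInclusion, P.adaptedBasis_nonempty, fun B => ⟨B.standardBasis,
    B.coe_standardBasis, fun q q' => ?_, fun z i q => Subtype.ext ?_,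
    fun z i q => Subtype.ext ?_⟩⟩, fun P₁ P₂ =>
    ⟨SymplecticTorus.Polarization.existsUnique_isBKSOperator P₂ P₁,
    fun F hF => hF.isIntertwiningMap⟩⟩
  · rw [B.coe_standardBasis, B.coe_standardBasis, B.innerProd_standardSection]
  · change P.translation ⟨z, 𝒯.divLevel (B.W i)⟩ (B.standardBasis q : P.Amplitude) =
      _ • (B.standardBasis q : P.Amplitude)
    rw [B.coe_standardBasis, B.translation_W]
  · change P.translation ⟨z, 𝒯.divLevel (B.Wp i)⟩ (B.standardBasis q : P.Amplitude) =
      _ • (B.standardBasis (q + Pi.single i 1) : P.Amplitude)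
    rw [B.coe_standardBasis, B.coe_standardBasis, B.translation_Wp]
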